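/- Let $d\ge 1$, $l\ge 0$, and let $V$ be a solid harmonic polynomial of degree $l$ on $\mathbb{R}^d$ (a polynomial, homogeneous of degree $l$, with $\Delta V=0$). Let $f$ on $\mathbb{R}^d$ and $\tilde f$ on $\mathbb{R}^{d+2l}$ be radial functions with the same profile, i.e. $f(y)=\varphi(|y|)$ and $\tilde f(\tilde y)=\varphi(|\tilde y|)$ for one function $\varphi$. Polynomials and functions may be complex valued. Notation, in dimension $n$. Put $\gamma_n(\alpha)=2^\alpha\pi^{n/2}\,\Gamma(\tfrac{\alpha}{2})/\Gamma(\tfrac{n-\alpha}{2})$. For $0<\alpha<n$ the Riesz potential is $$(-\Delta)^{-\alpha/2}h(x)=\frac{1}{\gamma_n(\alpha)}\int_{\mathbb{R}^n}\frac{h(x-y)}{|y|^{n-\alpha}}\,dy .$$ For $\alpha>0$ the fractional Laplacian is $$(-\Delta)^{\alpha/2}h(x)=\frac{1}{\chi_{n,k}(\alpha)}\lim_{\varepsilon\to0^+}\int_{|y|\ge\varepsilon}\frac{-\Delta_y^k h(x)}{|y|^{n+\alpha}}\,dy ,\qquad \Delta^k_y h(x)=\sum_{j=0}^k(-1)^j\binom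 kj h\bigl(x+(\tfrac k2-j)y\bigr),$$ where $k$ is an even integer with $k>\alpha$ and $$\chi_{n,k}(\alpha)=-\gamma_n(-\alpha)\sum_{j=0}^k(-1)^j\binom kj\bigl|\tfrac k2-j\bigr|^\alpha ,$$ extended by continuity to the even integers $\alpha\in(0,k)$. We say that $(-\Delta)^{\alpha/2}h(x)$ is well defined if, for every such $k$, the truncated integrals converge absolutely and the limit exists, and the resulting value does not depend on $k$. Let $x\in\mathbb{R}^d$ and $\tilde x\in\mathbb{R}^{d+2l}$ with $|\tilde x|=|x|$. (i) Let $0<\alpha<d$. If $x\ne0$ and $y\mapsto V(y)f(y)|x-y|^{\alpha-d}$ is in $L^1(\mathbb{R}^d)$, then the integral defining $(-\Delta)^{-\alpha/2}(Vf)(x)$ converges absolutely, so does the one defining $(-\Delta)^{-\alpha/2}\tilde f(\tilde x)$ provided $V(x)\neq0$, and $$(-\Delta)^{-\alpha/2}(Vf)(x)=V(x)\,(-\Delta)^{-\alpha/2}\tilde f(\tilde x),$$ the right-hand side being read as $0$ if $V(x)=0$. If $x=0$ and $y\mapsto(1+|V(y)|)f(y)|y|^{\alpha-d}$ is in $L^1(\mathbb{R}^d)$,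 then both integrals converge absolutely and the same identity holds. (ii) Let $\alpha>0$. If $f$ is smooth in a neighbourhood of $x$ and $y\mapsto V(y)f(y)(1+|y|)^{-\alpha-d}$ is in $L^1(\mathbb{R}^d)$, then $(-\Delta)^{\alpha/2}(Vf)(x)$ is well defined, $(-\Delta)^{\alpha/2}\tilde f(\tilde x)$ is well defined unless $V$ vanishes identically, and $$(-\Delta)^{\alpha/2}(Vf)(x)=V(x)\,(-\Delta)^{\alpha/2}\tilde f(\tilde x),$$ the right-hand side being read as $0$ if $V\equiv0$. -/

import Mathlib

open Filter Topology MeasureTheory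
open scoped ContDiff

noncomputable section

namespace FracLap

/-- The function on `ℝ^d` defined by a polynomial in `d` variables (with complex coefficients;
real polynomials are included). -/
def polyFun {d : ℕ} (V : MvPolynomial (Fin d) ℂ) (x : EuclideanSpace ℝ (Fin d)) : ℂ :=
  MvPolynomial.eval (fun i => ((x i : ℝ) : ℂ)) V

/-- Solid harmonic polynomials of degree `l`: homogeneous of degree `l` and annihilated by the
Laplacian. -/
def IsSolidHarmonic {d : ℕ} (V : MvPolynomial (Fin d) ℂ) (l : ℕ) : Prop :=
  V.IsHomogeneous l ∧ ∑ i, MvPolynomial.pderiv i (MvPolynomial.pderiv i V) = 0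

/-- `γ_d(α) = 2^α π^{d/2} Γ(α/2) / Γ((d-α)/2)`. -/
def rieszGamma (d : ℕ) (α : ℝ) : ℝ :=
  2 ^ α * Real.pi ^ ((d : ℝ) / 2) * Real.Gamma (α / 2) / Real.Gamma (((d : ℝ) - α) / 2)

/-- The integrand `f(x-y) / |y|^{d-α}` of the Riesz potential. -/
def rieszIntegrand {d : ℕ} (α : ℝ) (f : EuclideanSpace ℝ (Fin d) → ℂ)
    (x y : EuclideanSpace ℝ (Fin d)) : ℂ :=
  f (x - y) / ((‖y‖ ^ ((d : ℝ) - α) : ℝ) : ℂ)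

/-- The integral defining the Riesz potential of `f` at `x` converges absolutely. -/
def RieszConverges {d : ℕ} (α : ℝ) (f : EuclideanSpace ℝ (Fin d) → ℂ)
    (x : EuclideanSpace ℝ (Fin d)) : Prop :=
  Integrable (rieszIntegrand α f x)

/-- The Riesz potential `(-Δ)^{-α/2} f (x)`, for `0 < α < d`. -/
def rieszPotential {d : ℕ} (α : ℝ) (f : EuclideanSpace ℝ (Fin d) → ℂ)
    (x : EuclideanSpace ℝ (Fin d)) : ℂ :=
  ((1 / rieszGamma d α : ℝ) : ℂ) * ∫ y, rieszIntegrand α f x y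

/-- The centered difference `Δ^k_y f(x) = ∑_{j=0}^k (-1)^j (k choose j) f(x + (k/2 - j) y)`. -/
def centeredDiff {d : ℕ} (k : ℕ) (f : EuclideanSpace ℝ (Fin d) → ℂ)
    (x y : EuclideanSpace ℝ (Fin d)) : ℂ :=
  ∑ j ∈ Finset.range (k + 1),
    (-1 : ℂ) ^ j * (k.choose j : ℂ) * f (x + ((k : ℝ) / 2 - (j : ℝ)) • y)

/-- The expression `-γ_d(-β) ∑_{j=0}^k (-1)^j (k choose j) |k/2 - j|^β`, meaningful as it stands
for `β > 0` not an even integer (at even integers `γ_d(-β)` has a pole). -/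
def chiFormula (d k : ℕ) (β : ℝ) : ℝ :=
  -rieszGamma d (-β) *
    ∑ j ∈ Finset.range (k + 1), (-1 : ℝ) ^ j * (k.choose j : ℝ) * |(k : ℝ) / 2 - (j : ℝ)| ^ β

/-- The normalising constant `χ_{d,k}(α)`, for `k` even and `0 < α < k`: the continuous extension
of `chiFormula` through its removable singularities at even integers. -/
def chi (d k : ℕ) (α : ℝ) : ℝ :=
  limUnder (𝓝[≠] α) (chiFormula d k)

/-- Simple poles of `Γ` at the non-positive integers. -/
theorem tendsto_mul_Gamma (m : ℕ) :
    ∃ c : ℝ, Tendsto (fun s : ℝ => (s + m) * Real.Gamma s) (𝓝[≠] (-(m : ℝ))) (𝓝 c) := by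
  induction m with
  | zero =>
    refine ⟨Real.Gamma (0 + 1), ?_⟩
    have h1 : Tendsto (fun s : ℝ => Real.Gamma (s + 1)) (𝓝[≠] (0 : ℝ))
        (𝓝 (Real.Gamma (0 + 1))) := by
      have hc : ContinuousAt Real.Gamma (0 + 1) :=
        (Real.differentiableAt_Gamma (fun n => by
          have := n.cast_nonneg (α := ℝ)
          intro h
          linarith)).continuousAt
      have h2 : Tendsto (fun s : ℝ => s + 1) (𝓝[≠] (0 : ℝ)) (𝓝 (0 + 1)) :=
        ((continuous_id.add continuous_const).tendsto (0 : ℝ)).mono_left nhdsWithin_le_nhds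
      exact hc.tendsto.comp h2
    have h0 : (-((0 : ℕ) : ℝ)) = 0 := by simp
    rw [h0]
    refine h1.congr' ?_
    filter_upwards [self_mem_nhdsWithin] with s hs
    rw [Real.Gamma_add_one hs]
    simp
  | succ m ih =>
    obtain ⟨c, hc⟩ := ih
    have hne : (-((m + 1 : ℕ) : ℝ)) ≠ 0 := by
      rw [neg_ne_zero]
      exact_mod_cast Nat.succ_ne_zero m
    refine ⟨c / (-((m + 1 : ℕ) : ℝ)), ?_⟩
    have h2 : Tendsto (fun s : ℝ => s + 1) (𝓝[≠] (-((m + 1 : ℕ) : ℝ))) (𝓝[≠] (-(m : ℝ))) := by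
      refine tendsto_nhdsWithin_iff.2 ⟨?_, ?_⟩
      · have h : Tendsto (fun s : ℝ => s + 1) (𝓝 (-((m + 1 : ℕ) : ℝ)))
            (𝓝 (-((m + 1 : ℕ) : ℝ) + 1)) :=
          (by fun_prop : Continuous fun s : ℝ => s + 1).tendsto _
        have he : (-((m + 1 : ℕ) : ℝ)) + 1 = -(m : ℝ) := by push_cast; ring
        rw [he] at h
        exact h.mono_left nhdsWithin_le_nhds
      · filter_upwards [self_mem_nhdsWithin] with s hs h
        apply hs
        simp only [Set.mem_singleton_iff] at h ⊢
        push_cast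
        linarith
    have h3 : Tendsto (fun s : ℝ => s) (𝓝[≠] (-((m + 1 : ℕ) : ℝ)))
        (𝓝 (-((m + 1 : ℕ) : ℝ))) := tendsto_id.mono_left nhdsWithin_le_nhds
    refine ((hc.comp h2).div h3 hne).congr' ?_
    filter_upwards [h3.eventually_ne hne] with s hs
    change (s + 1 + (m : ℝ)) * Real.Gamma (s + 1) / s = _
    rw [Real.Gamma_add_one hs]
    push_cast
    field_simp
    ring

theorem chiSum_eq_zero {k m : ℕ} (h : 2 * m < k) :
    ∑ j ∈ Finset.range (k + 1),
      (-1 : ℝ) ^ j * (k.choose j : ℝ) * |(k : ℝ) / 2 - (j : ℝ)| ^ (2 * m : ℝ) = 0 := by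
  have hP : ((Polynomial.C ((k : ℝ) / 2) - Polynomial.X) ^ (2 * m)).natDegree < k := by
    refine lt_of_le_of_lt (Polynomial.natDegree_pow_le) (lt_of_le_of_lt ?_ h)
    have : (Polynomial.C ((k : ℝ) / 2) - Polynomial.X).natDegree ≤ 1 := by compute_degree
    nlinarith
  have h0 := congrFun (Polynomial.fwdDiff_iter_eq_zero_of_degree_lt hP) 0
  rw [fwdDiff_iter_eq_sum_shift] at h0
  have h1 : (∑ j ∈ Finset.range (k + 1),
      (-1 : ℝ) ^ j * (k.choose j : ℝ) * |(k : ℝ) / 2 - (j : ℝ)| ^ (2 * m : ℝ))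
      = (-1) ^ k * ∑ j ∈ Finset.range (k + 1), ((-1 : ℤ) ^ (k - j) * (k.choose j : ℤ)) •
        ((Polynomial.C ((k : ℝ) / 2) - Polynomial.X) ^ (2 * m)).eval ((0 : ℝ) + j • (1 : ℝ)) := by
    rw [Finset.mul_sum]
    refine Finset.sum_congr rfl fun j hj => ?_
    have hj' : j ≤ k := by
      have := Finset.mem_range.1 hj
      omega
    have hs : (-1 : ℝ) ^ k * (-1) ^ (k - j) = (-1) ^ j := by
      rw [← pow_add, show k + (k - j) = j + 2 * (k - j) by omega, pow_add, pow_mul]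
      simp
    have he : |(k : ℝ) / 2 - (j : ℝ)| ^ (2 * m : ℝ) = ((k : ℝ) / 2 - j) ^ (2 * m) := by
      rw [show (2 * m : ℝ) = ((2 * m : ℕ) : ℝ) by push_cast; ring, Real.rpow_natCast,
        pow_mul, pow_mul, sq_abs]
    rw [he, ← hs]
    simp
    ring
  rw [h1, h0]
  simp

theorem chiSum_differentiableAt (k : ℕ) {α : ℝ} (hα : 0 < α) :
    DifferentiableAt ℝ (fun β : ℝ => ∑ j ∈ Finset.range (k + 1),
      (-1 : ℝ) ^ j * (k.choose j : ℝ) * |(k : ℝ) / 2 - (j : ℝ)| ^ β) α := by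
  refine DifferentiableAt.fun_sum fun j _ => DifferentiableAt.const_mul ?_ _
  rcases eq_or_ne |(k : ℝ) / 2 - (j : ℝ)| 0 with h | h
  · rw [h]
    refine (differentiableAt_const (0 : ℝ)).congr_of_eventuallyEq ?_
    filter_upwards [lt_mem_nhds hα] with β hβ
    exact Real.zero_rpow hβ.ne'
  · exact ((Real.hasStrictDerivAt_const_rpow
      (lt_of_le_of_ne (abs_nonneg _) h.symm) α).hasDerivAt).differentiableAt

/-- The limit which defines `chi` exists. -/
theorem tendsto_chiFormula (d k : ℕ) {α : ℝ} (h0 : 0 < α) (hk : α < k) :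
    Tendsto (chiFormula d k) (𝓝[≠] α) (𝓝 (chi d k α)) := by
  suffices h : ∃ c, Tendsto (chiFormula d k) (𝓝[≠] α) (𝓝 c) from
    tendsto_nhds_limUnder h
  set S : ℝ → ℝ := fun β => ∑ j ∈ Finset.range (k + 1),
      (-1 : ℝ) ^ j * (k.choose j : ℝ) * |(k : ℝ) / 2 - (j : ℝ)| ^ β with hS
  have hSd : DifferentiableAt ℝ S α := chiSum_differentiableAt k h0
  set A : ℝ → ℝ := fun β => -(2 ^ (-β) * Real.pi ^ ((d : ℝ) / 2) /
    Real.Gamma (((d : ℝ) - -β) / 2)) with hA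
  have hchi : ∀ β, chiFormula d k β = A β * (Real.Gamma (-β / 2) * S β) := by
    intro β
    simp only [chiFormula, rieszGamma, hA, hS]
    ring
  have hAc : ContinuousAt A α := by
    have hpos : 0 < ((d : ℝ) - -α) / 2 := by
      have := d.cast_nonneg (α := ℝ)
      linarith
    have hG : ContinuousAt (fun β : ℝ => Real.Gamma (((d : ℝ) - -β) / 2)) α :=
      ContinuousAt.comp (g := Real.Gamma) (f := fun β : ℝ => ((d : ℝ) - -β) / 2)
        (Real.differentiableAt_Gamma (fun n => by
          have := n.cast_nonneg (α := ℝ)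
          intro h
          linarith)).continuousAt (by fun_prop)
    have h2 : ContinuousAt (fun β : ℝ => (2 : ℝ) ^ (-β)) α :=
      ContinuousAt.rpow continuousAt_const (by fun_prop) (Or.inl two_ne_zero)
    exact ((h2.mul continuousAt_const).div hG (Real.Gamma_pos_of_pos hpos).ne').neg
  suffices h : ∃ c, Tendsto (fun β => Real.Gamma (-β / 2) * S β) (𝓝[≠] α) (𝓝 c) by
    obtain ⟨c, hc⟩ := h
    refine ⟨A α * c, ?_⟩
    simp only [funext hchi]
    exact (hAc.tendsto.mono_left nhdsWithin_le_nhds).mul hc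
  by_cases he : ∃ m : ℕ, α = 2 * m
  · obtain ⟨m, hm⟩ := he
    have hmk : 2 * m < k := by
      rw [hm] at hk
      exact_mod_cast hk
    have hS0 : S α = 0 := by
      rw [hm]
      exact chiSum_eq_zero hmk
    obtain ⟨c, hc⟩ := tendsto_mul_Gamma m
    have ht : Tendsto (fun β : ℝ => -β / 2) (𝓝[≠] α) (𝓝[≠] (-(m : ℝ))) := by
      refine tendsto_nhdsWithin_iff.2 ⟨?_, ?_⟩
      · have h : Tendsto (fun β : ℝ => -β / 2) (𝓝 α) (𝓝 (-α / 2)) :=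
          (by fun_prop : Continuous fun β : ℝ => -β / 2).tendsto α
        rw [show -α / 2 = -(m : ℝ) by rw [hm]; ring] at h
        exact h.mono_left nhdsWithin_le_nhds
      · filter_upwards [self_mem_nhdsWithin] with β hβ h
        apply hβ
        simp only [Set.mem_singleton_iff] at h ⊢
        linarith
    have hsl := hasDerivAt_iff_tendsto_slope.1 hSd.hasDerivAt
    refine ⟨-2 * (c * deriv S α), (((hc.comp ht).mul hsl).const_mul (-2)).congr' ?_⟩
    filter_upwards [self_mem_nhdsWithin] with β hβ
    have hb : β - α ≠ 0 := sub_ne_zero.2 hβ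
    simp only [Function.comp, slope_def_field, hS0, sub_zero]
    rw [show -β / 2 + (m : ℝ) = -(β - α) / 2 by rw [hm]; ring]
    field_simp
  · have hG : ContinuousAt (fun β : ℝ => Real.Gamma (-β / 2)) α :=
      ContinuousAt.comp (g := Real.Gamma) (f := fun β : ℝ => -β / 2)
        (Real.differentiableAt_Gamma (fun n h => he ⟨n, by linarith⟩)).continuousAt
        (by fun_prop)
    exact ⟨_, (hG.mul hSd.continuousAt).tendsto.mono_left nhdsWithin_le_nhds⟩

/-- The integrand `-Δ^k_y f(x) / |y|^{d+α}`. -/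
def fracIntegrand {d : ℕ} (α : ℝ) (k : ℕ) (f : EuclideanSpace ℝ (Fin d) → ℂ)
    (x y : EuclideanSpace ℝ (Fin d)) : ℂ :=
  -centeredDiff k f x y / ((‖y‖ ^ ((d : ℝ) + α) : ℝ) : ℂ)

/-- The fractional Laplacian `(-Δ)^{α/2} f (x)`, `α > 0`, is defined and equal to `L`: for every
even integer `k > α` the truncated integrals converge absolutely, and, divided by `χ_{d,k}(α)`,
they tend to `L` as `ε → 0+`. -/
def HasFracLaplacian {d : ℕ} (α : ℝ) (f : EuclideanSpace ℝ (Fin d) → ℂ)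
    (x : EuclideanSpace ℝ (Fin d)) (L : ℂ) : Prop :=
  ∀ k : ℕ, Even k → α < (k : ℝ) →
    (∀ ε : ℝ, 0 < ε →
      IntegrableOn (fracIntegrand α k f x) (Metric.ball (0 : EuclideanSpace ℝ (Fin d)) ε)ᶜ) ∧
    Tendsto
      (fun ε : ℝ => ((1 / chi d k α : ℝ) : ℂ) *
        ∫ y in (Metric.ball (0 : EuclideanSpace ℝ (Fin d)) ε)ᶜ, fracIntegrand α k f x y)
      (𝓝[>] 0) (𝓝 L)

end FracLap

end

/-! Everything reduces to Gaussian kernels. Completing the square and the mean value property of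
harmonic polynomials under Gaussian weights give, for the profile `e^{-s r²}`, that the integral of
`V(y) e^{-s|y|²} e^{-t|x-y|²}` is `V(x) (t/(s+t))^l (π/(s+t))^{d/2} e^{-st|x|²/(s+t)}`. The same
integral without `V` in dimension `d + 2l` carries `(π/(s+t))^{d/2+l}` instead, so the two differ by
the factor `(t/π)^l V(x)`, which is free of `s`. Injectivity of the Laplace transform in `r²` turns
this into an identity of integrals over almost every sphere, hence for every radial profile:
`integral_solidHarmonic_radial_mul_gaussian`.

Powers of the distance are superpositions of Gaussians: `Γ(β/2) r^{-β}` is the integral of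
`t^{β/2-1} e^{-t r²}` over `t > 0`. The factor `t^l` replaces `β` by `β + 2l`, which is exactly the
change of the Riesz exponent `n - α`, or of `n + α`, when `n = d` becomes `d + 2l`. The Gamma
factors and `π^l` are absorbed by the normalising constants. Absolute convergence in the higher
dimension comes from the identity for `|φ|` and Tonelli.

For the fractional Laplacian, centered differences of order `k > α` are `O(|y|^k)`, so the limit is
an absolutely convergent integral. Composing differences of orders `k` and `k'` symmetrically and
scaling gives independence of `k` (`chi_mul_fracInt`). Division by `chi` is legitimate because `chi`
is, up to a nonzero factor, a Mellin transform of an alternating Gaussian sum of constant sign,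
bounded away from zero also at even `α` (`chi_ne_zero`). -/

namespace FracLap

/-! ### Polynomial functions on Euclidean space -/

/-- Euclidean space `ℝ^n`. -/
abbrev Euc (n : ℕ) := EuclideanSpace ℝ (Fin n)

theorem polyFun_add {d : ℕ} (p q : MvPolynomial (Fin d) ℂ) (y : Euc d) :
    polyFun (p + q) y = polyFun p y + polyFun q y := by
  simp [polyFun]

theorem polyFun_mul {d : ℕ} (p q : MvPolynomial (Fin d) ℂ) (y : Euc d) :
    polyFun (p * q) y = polyFun p y * polyFun q y := by
  simp [polyFun]

theorem polyFun_sum {d : ℕ} {ι : Type*} (s : Finset ι) (p : ι → MvPolynomial (Fin d) ℂ)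
    (y : Euc d) : polyFun (∑ i ∈ s, p i) y = ∑ i ∈ s, polyFun (p i) y := by
  simp [polyFun]

@[simp] theorem polyFun_C {d : ℕ} (c : ℂ) (y : Euc d) :
    polyFun (MvPolynomial.C c) y = c := by
  simp [polyFun]

@[simp] theorem polyFun_X {d : ℕ} (i : Fin d) (y : Euc d) :
    polyFun (MvPolynomial.X i) y = (y i : ℂ) := by
  simp [polyFun]

theorem contDiff_polyFun {d : ℕ} (p : MvPolynomial (Fin d) ℂ) :
    ContDiff ℝ ∞ (polyFun p : Euc d → ℂ) := by
  induction p using MvPolynomial.induction_on with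
  | C a =>
    rw [show (polyFun (MvPolynomial.C a) : Euc d → ℂ) = fun _ => a from funext (polyFun_C a)]
    exact contDiff_const
  | add p q hp hq =>
    rw [show (polyFun (p + q) : Euc d → ℂ) = fun y => polyFun p y + polyFun q y from
      funext (polyFun_add p q)]
    exact hp.add hq
  | mul_X p i hp =>
    rw [show (polyFun (p * MvPolynomial.X i) : Euc d → ℂ) = fun y => polyFun p y * ((y i : ℝ) : ℂ)
      from funext fun y => by rw [polyFun_mul, polyFun_X]]
    exact hp.mul (Complex.ofRealCLM.contDiff.comp (contDiff_piLp_apply (p := 2)))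

theorem continuous_polyFun {d : ℕ} (p : MvPolynomial (Fin d) ℂ) :
    Continuous (polyFun p : Euc d → ℂ) := (contDiff_polyFun p).continuous

theorem differentiable_polyFun {d : ℕ} (p : MvPolynomial (Fin d) ℂ) :
    Differentiable ℝ (polyFun p : Euc d → ℂ) := (contDiff_polyFun p).differentiable (by simp)

theorem fderiv_polyFun {d : ℕ} (p : MvPolynomial (Fin d) ℂ) (i : Fin d) (y : Euc d) :
    fderiv ℝ (polyFun p) y (EuclideanSpace.single i 1) = polyFun (MvPolynomial.pderiv i p) y := by
  induction p using MvPolynomial.induction_on with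
  | C a =>
    have : (polyFun (MvPolynomial.C a) : Euc d → ℂ) = fun _ => a := funext (polyFun_C a)
    rw [this]
    simp [polyFun]
  | add p q hp hq =>
    have : (polyFun (p + q) : Euc d → ℂ) = polyFun p + polyFun q := funext (polyFun_add p q)
    rw [this, fderiv_add (differentiable_polyFun p y) (differentiable_polyFun q y), map_add,
      polyFun_add, ← hp, ← hq]
    rfl
  | mul_X p j hp =>
    have h1 : (polyFun (p * MvPolynomial.X j) : Euc d → ℂ)
        = polyFun p * polyFun (MvPolynomial.X j) := funext (polyFun_mul p _)
    have h2 : HasFDerivAt (polyFun (MvPolynomial.X j) : Euc d → ℂ)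
        (Complex.ofRealCLM.comp (EuclideanSpace.proj j : Euc d →L[ℝ] ℝ)) y := by
      have : (polyFun (MvPolynomial.X j) : Euc d → ℂ)
          = (Complex.ofRealCLM.comp (EuclideanSpace.proj j : Euc d →L[ℝ] ℝ)) := by
        ext y; simp
      rw [this]
      exact ContinuousLinearMap.hasFDerivAt _
    rw [h1, ((differentiable_polyFun p y).hasFDerivAt.mul h2).fderiv, Derivation.leibniz,
      polyFun_add]
    have h3 : ((EuclideanSpace.single i (1 : ℝ) : Euc d) j : ℂ)
        = polyFun (MvPolynomial.pderiv i (MvPolynomial.X j)) y := by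
      by_cases h : i = j
      · subst h; simp [polyFun]
      · simp [polyFun, MvPolynomial.pderiv_X_of_ne (Ne.symm h), Ne.symm h]
    simp only [smul_eq_mul, polyFun_mul, ← h3, ← hp]
    simp

theorem exists_norm_polyFun_le {d : ℕ} (p : MvPolynomial (Fin d) ℂ) :
    ∃ (C : ℝ) (N : ℕ), 0 ≤ C ∧ ∀ y : Euc d, ‖polyFun p y‖ ≤ C * (1 + ‖y‖) ^ N := by
  induction p using MvPolynomial.induction_on with
  | C a => exact ⟨‖a‖, 0, norm_nonneg _, fun y => by simp⟩
  | add p q hp hq =>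
    obtain ⟨C, N, hC, h⟩ := hp
    obtain ⟨C', N', hC', h'⟩ := hq
    refine ⟨C + C', N + N', by positivity, fun y => ?_⟩
    have h1 : 1 ≤ 1 + ‖y‖ := by linarith [norm_nonneg y]
    rw [polyFun_add, add_mul]
    refine (norm_add_le _ _).trans (add_le_add ((h y).trans ?_) ((h' y).trans ?_))
    · gcongr
      omega
    · gcongr
      omega
  | mul_X p i hp =>
    obtain ⟨C, N, hC, h⟩ := hp
    refine ⟨C, N + 1, hC, fun y => ?_⟩
    rw [polyFun_mul, polyFun_X, norm_mul, pow_succ, ← mul_assoc]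
    gcongr
    · exact h y
    · have : ‖((y i : ℝ) : ℂ)‖ ≤ ‖y‖ := by
        rw [Complex.norm_real]; exact PiLp.norm_apply_le y i
      linarith

theorem polyFun_smul {d l : ℕ} {V : MvPolynomial (Fin d) ℂ} (hV : V.IsHomogeneous l) (c : ℝ)
    (y : Euc d) : polyFun V (c • y) = (c : ℂ) ^ l * polyFun V y := by
  simp only [polyFun, MvPolynomial.eval_eq, Finset.mul_sum]
  refine Finset.sum_congr rfl fun m hm => ?_
  have hdeg : ∑ i, m i = l := by
    have := hV (MvPolynomial.mem_support_iff.1 hm)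
    rw [← this]
    simp [Finsupp.weight_apply, Finsupp.sum_fintype]
  simp only [PiLp.smul_apply, smul_eq_mul, Complex.ofReal_mul, mul_pow, Finset.prod_mul_distrib]
  rw [Finset.prod_pow_eq_pow_sum]
  have : ∑ i ∈ m.support, m i = l := by
    rw [← hdeg]
    exact Finset.sum_subset (Finset.subset_univ _) (by simp)
  rw [this]
  ring

/-! ### Gaussian integrals of harmonic polynomials -/

/-- Gaussians decay faster than any power. -/
theorem exists_exp_neg_mul_sq_le {d : ℕ} {t : ℝ} (ht : 0 < t) (x : Euc d) (N : ℝ) :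
    ∃ C : ℝ, 0 ≤ C ∧ ∀ y : Euc d, Real.exp (-t * ‖x - y‖ ^ 2) ≤ C * (1 + ‖y‖) ^ (-N) := by
  obtain ⟨n, hn⟩ := exists_nat_ge N
  refine ⟨(1 + ‖x‖) ^ n * (n.factorial * Real.exp (1 + 1 / (4 * t))), by positivity, fun y => ?_⟩
  have hy : 1 ≤ 1 + ‖y‖ := by linarith [norm_nonneg y]
  have hy0 : 0 < 1 + ‖y‖ := by linarith
  rw [Real.rpow_neg hy0.le, ← div_eq_mul_inv, le_div_iff₀ (by positivity)]
  set u := ‖x - y‖ with hu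
  have hu0 : 0 ≤ u := norm_nonneg _
  have h1 : (1 + ‖y‖) ^ N ≤ (1 + ‖x‖) ^ n * (1 + u) ^ n := by
    calc (1 + ‖y‖) ^ N ≤ (1 + ‖y‖) ^ (n : ℝ) := Real.rpow_le_rpow_of_exponent_le hy hn
      _ = (1 + ‖y‖) ^ n := Real.rpow_natCast _ _
      _ ≤ ((1 + ‖x‖) * (1 + u)) ^ n := by
        gcongr
        have : ‖y‖ ≤ ‖x‖ + u := by
          have := norm_sub_norm_le y x
          rw [norm_sub_rev] at this
          linarith
        nlinarith [norm_nonneg x]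
      _ = _ := mul_pow _ _ _
  have h2 : (1 + u) ^ n ≤ n.factorial * Real.exp (1 + u) := by
    have := Real.pow_div_factorial_le_exp (x := 1 + u) (by positivity) n
    rw [div_le_iff₀ (by positivity)] at this
    linarith
  have h3 : Real.exp (-t * u ^ 2) * Real.exp (1 + u) ≤ Real.exp (1 + 1 / (4 * t)) := by
    rw [← Real.exp_add]
    apply Real.exp_le_exp.2
    -- Completing the square bounds `u - t u²` by `1/(4t)`.
    have h4 : 1 / (4 * t) + t * u ^ 2 - u = (2 * t * u - 1) ^ 2 / (4 * t) := by
      field_simp; ring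
    have h5 : 0 ≤ (2 * t * u - 1) ^ 2 / (4 * t) := by positivity
    linarith
  calc Real.exp (-t * u ^ 2) * (1 + ‖y‖) ^ N
      ≤ Real.exp (-t * u ^ 2) * ((1 + ‖x‖) ^ n * (n.factorial * Real.exp (1 + u))) := by
        gcongr; exact h1.trans (by gcongr)
    _ = (1 + ‖x‖) ^ n * (n.factorial * (Real.exp (-t * u ^ 2) * Real.exp (1 + u))) := by ring
    _ ≤ _ := by gcongr

theorem integrable_polyFun_mul_gaussian {d : ℕ} (p : MvPolynomial (Fin d) ℂ) {t : ℝ} (ht : 0 < t)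
    (x : Euc d) :
    Integrable fun y : Euc d => polyFun p y * (Real.exp (-t * ‖x - y‖ ^ 2) : ℂ) := by
  obtain ⟨C, N, hC, h⟩ := exists_norm_polyFun_le p
  obtain ⟨C', hC', h'⟩ := exists_exp_neg_mul_sq_le ht x (N + (d + 1))
  have hi : Integrable fun y : Euc d => (C * C') * (1 + ‖y‖) ^ (-((d : ℝ) + 1)) :=
    (integrable_one_add_norm (by simp)).const_mul _
  refine hi.mono' ?_ (ae_of_all _ fun y => ?_)
  · refine Continuous.aestronglyMeasurable ?_
    have := continuous_polyFun p
    fun_prop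
  · have hy0 : 0 < 1 + ‖y‖ := by linarith [norm_nonneg y]
    rw [norm_mul, Complex.norm_real, Real.norm_of_nonneg (Real.exp_pos _).le]
    refine (mul_le_mul (h y) (h' y) (Real.exp_pos _).le (by positivity)).trans_eq ?_
    rw [neg_add, Real.rpow_add hy0, Real.rpow_neg hy0.le (N : ℝ), Real.rpow_natCast]
    field_simp

/-- A derivative lowers the degree of a monomial by one or kills it. Consequently the homogeneous
components of a harmonic polynomial are harmonic. -/
theorem homogeneousComponent_pderiv {d : ℕ} (p : MvPolynomial (Fin d) ℂ) (i : Fin d) (m : ℕ) :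
    MvPolynomial.homogeneousComponent m (MvPolynomial.pderiv i p)
      = MvPolynomial.pderiv i (MvPolynomial.homogeneousComponent (m + 1) p) := by
  induction p using MvPolynomial.induction_on' with
  | add p q hp hq => simp only [map_add, hp, hq]
  | monomial u a =>
    rw [MvPolynomial.pderiv_monomial]
    by_cases hu : u i = 0
    · have h : MvPolynomial.pderiv i (MvPolynomial.homogeneousComponent (m + 1)
          (MvPolynomial.monomial u a)) = 0 := by
        by_cases hm : u.degree = m + 1
        · rw [MvPolynomial.homogeneousComponent_of_mem
            (MvPolynomial.isHomogeneous_monomial a hm), if_pos rfl, MvPolynomial.pderiv_monomial]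
          simp [hu]
        · rw [MvPolynomial.homogeneousComponent_of_mem
            (MvPolynomial.isHomogeneous_monomial a rfl), if_neg (Ne.symm hm), map_zero]
      rw [h, hu]
      simp
    · have hdeg : (u - Finsupp.single i 1).degree + 1 = u.degree := by
        have h1 : u - Finsupp.single i 1 + Finsupp.single i 1 = u :=
          tsub_add_cancel_of_le (by
            rw [Finsupp.single_le_iff]; omega)
        conv_rhs => rw [← h1]
        rw [map_add, Finsupp.degree_single]
      rw [MvPolynomial.homogeneousComponent_of_mem
          (MvPolynomial.isHomogeneous_monomial _ rfl),
        MvPolynomial.homogeneousComponent_of_mem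
          (MvPolynomial.isHomogeneous_monomial a rfl)]
      by_cases hm : u.degree = m + 1
      · rw [if_pos (by omega), if_pos hm.symm, MvPolynomial.pderiv_monomial]
      · rw [if_neg (by omega), if_neg (Ne.symm hm), map_zero]

theorem laplacian_homogeneousComponent {d : ℕ} {p : MvPolynomial (Fin d) ℂ}
    (hp : ∑ i, MvPolynomial.pderiv i (MvPolynomial.pderiv i p) = 0) (m : ℕ) :
    ∑ i, MvPolynomial.pderiv i (MvPolynomial.pderiv i
      (MvPolynomial.homogeneousComponent m p)) = 0 := by
  -- In degrees 0 and 1 second derivatives vanish anyway; otherwise the expression is the component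
  -- of degree `m` of the Laplacian.
  match m with
  | 0 => simp [MvPolynomial.homogeneousComponent_zero]
  | 1 =>
    simp only [← homogeneousComponent_pderiv, MvPolynomial.homogeneousComponent_zero,
      MvPolynomial.pderiv_C, Finset.sum_const_zero]
  | m + 2 =>
    simp only [← homogeneousComponent_pderiv]
    rw [← map_sum, hp, map_zero]

/-- The polynomial `y ↦ p (y + a)`. -/
noncomputable def translatePoly {d : ℕ} (a : Euc d) (p : MvPolynomial (Fin d) ℂ) : MvPolynomial (Fin d) ℂ :=
  MvPolynomial.aeval (fun i => MvPolynomial.X i + MvPolynomial.C ((a i : ℝ) : ℂ)) p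

theorem polyFun_translatePoly {d : ℕ} (a : Euc d) (p : MvPolynomial (Fin d) ℂ) (y : Euc d) :
    polyFun (translatePoly a p) y = polyFun p (y + a) := by
  induction p using MvPolynomial.induction_on with
  | C c => simp [translatePoly, polyFun]
  | add p q hp hq =>
    rw [polyFun_add, ← hp, ← hq, ← polyFun_add, translatePoly, map_add]; rfl
  | mul_X p i hp =>
    have : translatePoly a (p * MvPolynomial.X i)
        = translatePoly a p * (MvPolynomial.X i + MvPolynomial.C ((a i : ℝ) : ℂ)) := by
      simp [translatePoly]
    rw [this, polyFun_mul, polyFun_mul, hp, polyFun_add]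
    simp

theorem pderiv_translatePoly {d : ℕ} (a : Euc d) (p : MvPolynomial (Fin d) ℂ) (i : Fin d) :
    MvPolynomial.pderiv i (translatePoly a p) = translatePoly a (MvPolynomial.pderiv i p) := by
  induction p using MvPolynomial.induction_on with
  | C c => simp [translatePoly]
  | add p q hp hq => simp only [translatePoly, map_add] at *; rw [hp, hq]
  | mul_X p j hp =>
    simp only [translatePoly, map_mul, MvPolynomial.aeval_X, Derivation.leibniz, map_add,
      smul_eq_mul, MvPolynomial.pderiv_C, add_zero] at *
    rw [hp]
    by_cases h : i = j
    · subst h; simp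
    · simp [MvPolynomial.pderiv_X_of_ne (Ne.symm h)]

theorem integral_gaussian {d : ℕ} {c : ℝ} (hc : 0 < c) :
    ∫ y : Euc d, (Real.exp (-c * ‖y‖ ^ 2) : ℂ) = ((Real.pi / c) ^ ((d : ℝ) / 2) : ℝ) := by
  rw [integral_complex_ofReal, GaussianFourier.integral_rexp_neg_mul_sq_norm hc]
  simp

theorem integrable_polyFun_mul_centered_gaussian {d : ℕ} (p : MvPolynomial (Fin d) ℂ) {t : ℝ}
    (ht : 0 < t) :
    Integrable fun y : Euc d => polyFun p y * (Real.exp (-t * ‖y‖ ^ 2) : ℂ) := by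
  simpa using integrable_polyFun_mul_gaussian p ht (0 : Euc d)

/-- Integration by parts: the `i`-th derivative of the Gaussian is `-2c y_i` times it. -/
theorem integral_X_mul_gaussian {d : ℕ} (p : MvPolynomial (Fin d) ℂ) {c : ℝ} (hc : 0 < c)
    (i : Fin d) :
    ((2 * c : ℝ) : ℂ) * ∫ y : Euc d, polyFun (MvPolynomial.X i * p) y
        * (Real.exp (-c * ‖y‖ ^ 2) : ℂ)
      = ∫ y : Euc d, polyFun (MvPolynomial.pderiv i p) y * (Real.exp (-c * ‖y‖ ^ 2) : ℂ) := by
  set g : Euc d → ℂ := fun y => (Real.exp (-c * ‖y‖ ^ 2) : ℂ) with hg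
  have hdiff : ∀ y : Euc d, HasFDerivAt g (Complex.ofRealCLM.comp
      (Real.exp (-c * ‖y‖ ^ 2) • (-c) • (2 • (innerSL ℝ y : Euc d →L[ℝ] ℝ)))) y := fun y =>
    Complex.ofRealCLM.hasFDerivAt.comp y
      (((hasStrictFDerivAt_norm_sq y).hasFDerivAt.const_mul (-c)).exp)
  have hfd : ∀ y : Euc d, fderiv ℝ g y (EuclideanSpace.single i 1)
      = ((-(2 * c) : ℝ) : ℂ) * ((y i : ℂ) * g y) := by
    intro y
    rw [(hdiff y).fderiv]
    simp [hg, EuclideanSpace.inner_single_right]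
    ring
  have h := integral_mul_fderiv_eq_neg_fderiv_mul_of_integrable (μ := volume)
    (f := (polyFun p : Euc d → ℂ)) (g := g) (v := EuclideanSpace.single i 1) (𝕜 := ℂ) ?_ ?_ ?_
    (fun y _ => differentiable_polyFun p y) (fun y _ => (hdiff y).differentiableAt)
  · simp only [hfd, fderiv_polyFun] at h
    rw [← neg_eq_iff_eq_neg, ← integral_neg] at h
    rw [← h, ← integral_const_mul]
    congr 1
    ext y
    rw [polyFun_mul, polyFun_X]
    simp only [hg]
    push_cast
    ring
  · simp only [fderiv_polyFun]
    exact integrable_polyFun_mul_centered_gaussian _ hc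
  · simp only [hfd]
    refine ((integrable_polyFun_mul_centered_gaussian (MvPolynomial.X i * p) hc).const_mul
      ((-(2 * c) : ℝ) : ℂ)).congr (ae_of_all _ fun y => ?_)
    simp only [polyFun_mul, polyFun_X, hg]
    ring
  · exact integrable_polyFun_mul_centered_gaussian p hc

/-- By Euler's identity `m p = ∑ y_i ∂_i p`; integration by parts turns each `y_i` into another
`∂_i`, so the Laplacian of `p` appears. -/
theorem integral_harmonic_homogeneous_mul_gaussian {d m : ℕ} {p : MvPolynomial (Fin d) ℂ}
    (hp : IsSolidHarmonic p m) (hm : m ≠ 0) {c : ℝ} (hc : 0 < c) :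
    ∫ y : Euc d, polyFun p y * (Real.exp (-c * ‖y‖ ^ 2) : ℂ) = 0 := by
  have h1 : ∀ y : Euc d, (m : ℂ) * polyFun p y
      = ∑ i, polyFun (MvPolynomial.X i * MvPolynomial.pderiv i p) y := by
    intro y
    rw [← polyFun_sum, hp.1.sum_X_mul_pderiv]
    simp [polyFun]
  have h2 : ((2 * c : ℝ) : ℂ) * ((m : ℂ) *
      ∫ y : Euc d, polyFun p y * (Real.exp (-c * ‖y‖ ^ 2) : ℂ)) = 0 := by
    rw [← integral_const_mul]
    simp only [← mul_assoc, h1, Finset.sum_mul]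
    rw [integral_finsetSum _ fun i _ => integrable_polyFun_mul_centered_gaussian _ hc,
      Finset.mul_sum]
    simp only [integral_X_mul_gaussian _ hc]
    rw [← integral_finsetSum _ fun i _ => integrable_polyFun_mul_centered_gaussian _ hc]
    simp only [← Finset.sum_mul, ← polyFun_sum, hp.2]
    simp [polyFun]
  have hc' : ((2 * c : ℝ) : ℂ) ≠ 0 := by
    rw [Complex.ofReal_ne_zero]; positivity
  simpa [hc', hm, hc.ne'] using h2

/-- Only the constant component survives. Homogeneity is not required because the lemma is applied
to a translate of `V`. -/
theorem integral_harmonic_mul_gaussian {d : ℕ} {p : MvPolynomial (Fin d) ℂ}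
    (hp : ∑ i, MvPolynomial.pderiv i (MvPolynomial.pderiv i p) = 0) {c : ℝ} (hc : 0 < c) :
    ∫ y : Euc d, polyFun p y * (Real.exp (-c * ‖y‖ ^ 2) : ℂ)
      = polyFun p 0 * ((Real.pi / c) ^ ((d : ℝ) / 2) : ℝ) := by
  have h0 : polyFun p (0 : Euc d) = MvPolynomial.coeff 0 p := by
    simp [polyFun, ← MvPolynomial.constantCoeff_eq, MvPolynomial.eval_zero']
  conv_lhs => rw [← MvPolynomial.sum_homogeneousComponent p]
  simp only [polyFun_sum, Finset.sum_mul]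
  rw [integral_finsetSum _ fun i _ => integrable_polyFun_mul_centered_gaussian _ hc,
    Finset.sum_eq_single_of_mem 0 (by simp)]
  · rw [MvPolynomial.homogeneousComponent_zero, h0, ← integral_gaussian hc]
    simp only [polyFun_C]
    rw [integral_const_mul]
  · intro m _ hm
    exact integral_harmonic_homogeneous_mul_gaussian
      ⟨MvPolynomial.homogeneousComponent_isHomogeneous m p, laplacian_homogeneousComponent hp m⟩
      hm hc

/-- Gaussian mean value property of solid harmonics, after completing the square. -/
theorem integral_solidHarmonic_mul_gaussian {d l : ℕ} {V : MvPolynomial (Fin d) ℂ}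
    (hV : IsSolidHarmonic V l) (x : Euc d) {s t : ℝ} (hs : 0 < s) (ht : 0 < t) :
    ∫ y : Euc d, polyFun V y *
        ((Real.exp (-s * ‖y‖ ^ 2) * Real.exp (-t * ‖x - y‖ ^ 2) : ℝ) : ℂ)
      = polyFun V x * (((t / (s + t)) ^ l * (Real.pi / (s + t)) ^ ((d : ℝ) / 2) *
        Real.exp (-(s * t / (s + t)) * ‖x‖ ^ 2) : ℝ) : ℂ) := by
  have hst : 0 < s + t := by positivity
  -- The centre of the product of the two Gaussians; by homogeneity `V(a) = (t/(s+t))^l V(x)`.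
  set a : Euc d := (t / (s + t)) • x with ha
  have hp : ∑ i, MvPolynomial.pderiv i (MvPolynomial.pderiv i (translatePoly a V)) = 0 := by
    have := congrArg (translatePoly a) hV.2
    simp only [pderiv_translatePoly]
    simpa only [translatePoly, map_sum, map_zero] using this
  have hsq : ∀ y : Euc d, Real.exp (-s * ‖y + a‖ ^ 2) * Real.exp (-t * ‖x - (y + a)‖ ^ 2)
      = Real.exp (-(s * t / (s + t)) * ‖x‖ ^ 2) * Real.exp (-(s + t) * ‖y‖ ^ 2) := by
    intro y
    rw [← Real.exp_add, ← Real.exp_add]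
    congr 1
    have h1 : x - (y + a) = (s / (s + t)) • x - y := by
      have : x = (s / (s + t)) • x + (t / (s + t)) • x := by
        rw [← add_smul, ← add_div, div_self hst.ne', one_smul]
      rw [ha]
      nth_rewrite 1 [this]
      abel
    rw [h1, norm_add_sq_real, norm_sub_sq_real, ha, norm_smul, norm_smul, real_inner_smul_right,
      real_inner_smul_left, real_inner_comm, Real.norm_of_nonneg (by positivity),
      Real.norm_of_nonneg (by positivity)]
    field_simp
    ring
  rw [← integral_add_right_eq_self _ a]
  simp only [hsq, ← polyFun_translatePoly]
  have h := integral_harmonic_mul_gaussian hp hst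
  simp only [Complex.ofReal_mul, mul_left_comm (polyFun (translatePoly a V) _)]
  rw [integral_const_mul, h, polyFun_translatePoly, zero_add, ha, polyFun_smul hV.1]
  push_cast
  ring

/-! ### Polar coordinates -/

section Polar

variable {d : ℕ}

theorem integrable_polar {F : Euc d → ℂ} (hF : Integrable F) :
    Integrable (fun p : Metric.sphere (0 : Euc d) 1 × Set.Ioi (0 : ℝ) => F (p.2.1 • p.1.1))
      ((volume : Measure (Euc d)).toSphere.prod (Measure.volumeIoiPow (d - 1))) := by
  have h := (volume : Measure (Euc d)).measurePreserving_homeomorphUnitSphereProd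
  rw [finrank_euclideanSpace_fin] at h
  rw [← h.integrable_comp_emb (Homeomorph.measurableEmbedding _)]
  have : ((fun p : Metric.sphere (0 : Euc d) 1 × Set.Ioi (0 : ℝ) => F (p.2.1 • p.1.1)) ∘
      homeomorphUnitSphereProd (Euc d)) = fun y : ({0}ᶜ : Set (Euc d)) => F y := by
    ext y
    have hy : ‖(y : Euc d)‖ ≠ 0 := norm_ne_zero_iff.2 y.2
    simp [smul_smul, hy]
  rw [this]
  exact (integrableOn_iff_comap_subtypeVal (measurableSet_singleton _).compl).1 hF.integrableOn

theorem integral_polar_prod [Nontrivial (Euc d)] (F : Euc d → ℂ) :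
    ∫ y, F y = ∫ p : Metric.sphere (0 : Euc d) 1 × Set.Ioi (0 : ℝ), F (p.2.1 • p.1.1)
      ∂((volume : Measure (Euc d)).toSphere.prod (Measure.volumeIoiPow (d - 1))) := by
  have h := (volume : Measure (Euc d)).measurePreserving_homeomorphUnitSphereProd
  rw [finrank_euclideanSpace_fin] at h
  rw [← h.integral_comp (Homeomorph.measurableEmbedding _)]
  have hy : ∀ y : ({0}ᶜ : Set (Euc d)), F ((homeomorphUnitSphereProd (Euc d) y).2.1 •
      (homeomorphUnitSphereProd (Euc d) y).1.1) = F y := fun y => by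
    have hy : ‖(y : Euc d)‖ ≠ 0 := norm_ne_zero_iff.2 y.2
    simp [smul_smul, hy]
  simp only [hy]
  rw [integral_subtype_comap (measurableSet_singleton _).compl, restrict_compl_singleton]

/-- `r^{d-1}` times the integral of `F` over the sphere of radius `r`. -/
noncomputable def sphereIntegral (F : Euc d → ℂ) (r : ℝ) : ℂ :=
  ((r ^ (d - 1) : ℝ) : ℂ) * ∫ σ : Metric.sphere (0 : Euc d) 1, F (r • σ.1)
    ∂(volume : Measure (Euc d)).toSphere

theorem integrableOn_volumeIoiPow_iff {n : ℕ} {g : ℝ → ℂ} :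
    Integrable (fun r : Set.Ioi (0 : ℝ) => g r) (Measure.volumeIoiPow n) ↔
      IntegrableOn (fun r => ((r ^ n : ℝ) : ℂ) * g r) (Set.Ioi 0) := by
  rw [Measure.volumeIoiPow, integrable_withDensity_iff_integrable_smul',
    integrableOn_iff_comap_subtypeVal measurableSet_Ioi]
  · refine integrable_congr (ae_of_all _ fun r => ?_)
    have : (0 : ℝ) ≤ (r : ℝ) ^ n := pow_nonneg r.2.out.le _
    simp [ENNReal.toReal_ofReal this]
  · fun_prop
  · simp

theorem integral_volumeIoiPow {n : ℕ} (g : ℝ → ℂ) :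
    ∫ r : Set.Ioi (0 : ℝ), g r ∂(Measure.volumeIoiPow n)
      = ∫ r in Set.Ioi 0, ((r ^ n : ℝ) : ℂ) * g r := by
  simp only [Measure.volumeIoiPow, ENNReal.ofReal]
  rw [integral_withDensity_eq_integral_smul,
    integral_subtype_comap measurableSet_Ioi fun a : ℝ ↦ Real.toNNReal (a ^ n) • g a,
    setIntegral_congr_fun measurableSet_Ioi fun x hx ↦ ?_]
  · rw [NNReal.smul_def, Real.coe_toNNReal _ (pow_nonneg hx.out.le _), Complex.real_smul]
  · exact (measurable_subtype_coe.pow_const _).real_toNNReal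

theorem integrableOn_sphereIntegral {F : Euc d → ℂ} (hF : Integrable F) :
    IntegrableOn (sphereIntegral F) (Set.Ioi 0) :=
  integrableOn_volumeIoiPow_iff.1 (integrable_polar hF).integral_prod_right

theorem integral_eq_integral_sphereIntegral [Nontrivial (Euc d)] {F : Euc d → ℂ} (hF : Integrable F) :
    ∫ y, F y = ∫ r in Set.Ioi 0, sphereIntegral F r := by
  rw [integral_polar_prod, integral_prod_symm _ (integrable_polar hF)]
  exact integral_volumeIoiPow (fun r => ∫ σ : Metric.sphere (0 : Euc d) 1, F (r • σ.1)
    ∂(volume : Measure (Euc d)).toSphere)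

/-- A radial factor is constant on each sphere, so an identity between sphere integrals yields one
for all profiles. -/
theorem sphereIntegral_radial_mul (φ : ℝ → ℂ) (F : Euc d → ℂ) {r : ℝ} (hr : 0 < r) :
    sphereIntegral (fun y => φ ‖y‖ * F y) r = φ r * sphereIntegral F r := by
  have h : ∀ σ : Metric.sphere (0 : Euc d) 1, φ ‖r • σ.1‖ = φ r := fun σ => by
    have : ‖(σ : Euc d)‖ = 1 := by simp
    simp [norm_smul, this, abs_of_pos hr]
  simp only [sphereIntegral, h]
  rw [integral_const_mul, mul_left_comm]

end Polar

/-! ### Uniqueness for the Laplace transform -/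

/-- Injectivity of the Laplace transform in the variable `r²`. -/
theorem ae_eq_zero_of_integral_exp_mul_eq_zero {g : ℝ → ℂ} (hg : IntegrableOn g (Set.Ioi 0))
    (h : ∀ s : ℝ, 0 < s → ∫ r in Set.Ioi 0, (Real.exp (-s * r ^ 2) : ℂ) * g r = 0) :
    ∀ᵐ r ∂volume.restrict (Set.Ioi (0 : ℝ)), g r = 0 := by
  -- The spare factor `e^{-r²}` makes every monomial `u^n` in `u = e^{-r²}`, including `n = 0`,
  -- correspond to an exponent `s = n + 1 > 0`.
  set g₁ : ℝ → ℂ := fun r => (Real.exp (-1 * r ^ 2) : ℂ) * g r with hg₁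
  have hexp : ∀ r : ℝ, 0 ≤ Real.exp (-1 * r ^ 2) ∧ Real.exp (-1 * r ^ 2) ≤ 1 := fun r =>
    ⟨(Real.exp_pos _).le, Real.exp_le_one_iff.2 (by nlinarith [sq_nonneg r])⟩
  have hmul : ∀ {u : ℝ → ℝ} {C : ℝ} {f : ℝ → ℂ}, Measurable u → IntegrableOn f (Set.Ioi 0) →
      (∀ r, |u r| ≤ C) → IntegrableOn (fun r => (u r : ℂ) * f r) (Set.Ioi 0) := by
    intro u C f hu hf hC
    refine Integrable.bdd_mul hf (c := C) ?_ (ae_of_all _ fun r => ?_)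
    · exact (Complex.measurable_ofReal.comp hu).aestronglyMeasurable
    · simpa using hC r
  have hg₁i : IntegrableOn g₁ (Set.Ioi 0) :=
    hmul (C := 1) (by fun_prop) hg fun r => by
      rw [abs_of_nonneg (hexp r).1]; exact (hexp r).2
  have hpoly_i : ∀ p : Polynomial ℝ, IntegrableOn
      (fun r => ((p.eval (Real.exp (-1 * r ^ 2)) : ℝ) : ℂ) * g₁ r) (Set.Ioi 0) := by
    intro p
    obtain ⟨C, hC⟩ := isCompact_Icc.exists_bound_of_continuousOn (s := Set.Icc (0 : ℝ) 1)
      p.continuous.continuousOn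
    exact hmul (C := C) (by fun_prop) hg₁i fun r => hC _ (hexp r)
  have hpoly : ∀ p : Polynomial ℝ,
      ∫ r in Set.Ioi 0, ((p.eval (Real.exp (-1 * r ^ 2)) : ℝ) : ℂ) * g₁ r = 0 := by
    intro p
    induction p using Polynomial.induction_on' with
    | add p q hp hq =>
      simp only [Polynomial.eval_add, Complex.ofReal_add, add_mul]
      rw [integral_add (hpoly_i p) (hpoly_i q), hp, hq, add_zero]
    | monomial n a =>
      have h1 := h (n + 1) (by positivity)
      have h2 : ∀ r : ℝ, (((Polynomial.monomial n a).eval (Real.exp (-1 * r ^ 2)) : ℝ) : ℂ) * g₁ r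
          = (a : ℂ) * ((Real.exp (-((n : ℝ) + 1) * r ^ 2) : ℂ) * g r) := by
        intro r
        have : Real.exp (-((n : ℝ) + 1) * r ^ 2)
            = Real.exp (-1 * r ^ 2) ^ n * Real.exp (-1 * r ^ 2) := by
          rw [← Real.exp_nat_mul, ← Real.exp_add]
          congr 1; ring
        rw [this, Polynomial.eval_monomial, hg₁]
        push_cast
        ring
      simp only [h2]
      rw [integral_const_mul, h1, mul_zero]
  -- Weierstrass approximation passes from polynomials in `u` to continuous functions of `u` on
  -- `[0,1]`.
  have hcont : ∀ f : ℝ → ℝ, ContinuousOn f (Set.Icc 0 1) →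
      IntegrableOn (fun r => ((f (Real.exp (-1 * r ^ 2)) : ℝ) : ℂ) * g₁ r) (Set.Ioi 0) →
      ∫ r in Set.Ioi 0, ((f (Real.exp (-1 * r ^ 2)) : ℝ) : ℂ) * g₁ r = 0 := by
    intro f hf hfi
    set K := ∫ r in Set.Ioi 0, ‖g₁ r‖ with hK
    have hK0 : 0 ≤ K := integral_nonneg fun r => norm_nonneg _
    rw [← norm_le_zero_iff]
    refine le_of_forall_pos_le_add fun ε hε => ?_
    obtain ⟨p, hp⟩ := exists_polynomial_near_of_continuousOn 0 1 f hf (ε / (K + 1)) (by positivity)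
    have h1 : ∫ r in Set.Ioi 0, ((f (Real.exp (-1 * r ^ 2)) : ℝ) : ℂ) * g₁ r
        = ∫ r in Set.Ioi 0, (((f (Real.exp (-1 * r ^ 2)) : ℝ) : ℂ) * g₁ r
          - ((p.eval (Real.exp (-1 * r ^ 2)) : ℝ) : ℂ) * g₁ r) := by
      rw [integral_sub hfi (hpoly_i p), hpoly, sub_zero]
    rw [h1, zero_add]
    calc _ ≤ ∫ r in Set.Ioi 0, ε / (K + 1) * ‖g₁ r‖ := by
          refine norm_integral_le_of_norm_le (hg₁i.norm.const_mul _) (ae_of_all _ fun r => ?_)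
          rw [← sub_mul, norm_mul, ← Complex.ofReal_sub, Complex.norm_real, norm_sub_rev]
          exact mul_le_mul_of_nonneg_right (hp _ (hexp r)).le (norm_nonneg _)
      _ = ε / (K + 1) * K := integral_const_mul _ _
      _ ≤ ε := by
        rw [div_mul_eq_mul_div, div_le_iff₀ (by positivity)]
        nlinarith
  have hae := isOpen_Ioi.ae_eq_zero_of_integral_contDiff_smul_eq_zero (μ := volume) (f := g₁)
    (U := Set.Ioi (0 : ℝ)) hg₁i.locallyIntegrableOn ?_
  · rw [ae_restrict_iff' measurableSet_Ioi]
    filter_upwards [hae] with r hr h0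
    have := hr h0
    simpa [hg₁] using this
  intro ψ hψ hψc hψs
  have hψ0 : ∀ r ≤ 0, ψ r = 0 := fun r hr => image_eq_zero_of_notMem_tsupport fun hr' =>
    absurd (hψs hr') (not_lt.2 hr)
  -- A test function of `r` rewritten in terms of `u = e^{-r²}`. At `u = 0`, that is `r = ∞`, it is
  -- continuous because `ψ` has compact support.
  set f : ℝ → ℝ := fun u => ψ (Real.sqrt (-Real.log u)) with hf
  have hfexp : ∀ r, 0 < r → f (Real.exp (-1 * r ^ 2)) = ψ r := by
    intro r hr
    rw [hf]
    simp only [Real.log_exp]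
    rw [show -(-1 * r ^ 2) = r ^ 2 by ring, Real.sqrt_sq hr.le]
  have hfc : ContinuousOn f (Set.Icc 0 1) := by
    intro u hu
    rcases eq_or_lt_of_le hu.1 with h0 | h0
    · obtain ⟨R, hR⟩ := hψc.isCompact.isBounded.subset_closedBall 0
      have hzero : ∀ v : ℝ, 0 ≤ v → v < Real.exp (-(|R| + 1) ^ 2) → f v = 0 := by
        intro v hv0 hv
        rcases eq_or_lt_of_le hv0 with hv0 | hv0
        · rw [hf, ← hv0]
          simpa using hψ0 0 le_rfl
        · refine image_eq_zero_of_notMem_tsupport (f := ψ) fun hm => ?_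
          have h1 := hR hm
          rw [mem_closedBall_zero_iff, Real.norm_eq_abs, abs_of_nonneg (Real.sqrt_nonneg _)] at h1
          have h2 : Real.log v < -(|R| + 1) ^ 2 := (Real.log_lt_iff_lt_exp hv0).2 hv
          have h3 : |R| + 1 ≤ Real.sqrt (-Real.log v) := Real.le_sqrt_of_sq_le (by linarith)
          linarith [le_abs_self R]
      have hu0 : f u = 0 := hzero u hu.1 (by rw [← h0]; exact Real.exp_pos _)
      refine (continuousWithinAt_const (b := (0 : ℝ))).congr_of_eventuallyEq ?_ hu0
      have : Set.Iio (Real.exp (-(|R| + 1) ^ 2)) ∈ 𝓝[Set.Icc 0 1] u :=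
        mem_nhdsWithin_of_mem_nhds (Iio_mem_nhds (by rw [← h0]; exact Real.exp_pos _))
      filter_upwards [this, self_mem_nhdsWithin] with v hv hv'
      exact hzero v hv'.1 hv
    · refine ContinuousAt.continuousWithinAt ?_
      exact hψ.continuous.continuousAt.comp
        (Real.continuous_sqrt.continuousAt.comp (Real.continuousAt_log h0.ne').neg)
  have hfi : IntegrableOn (fun r => ((ψ r : ℝ) : ℂ) * g₁ r) (Set.Ioi 0) := by
    obtain ⟨C, hC⟩ := hψc.exists_bound_of_continuous hψ.continuous
    exact hmul (C := C) hψ.continuous.measurable hg₁i hC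
  have key := hcont f hfc (hfi.congr_fun (fun r hr => by
    rw [hfexp r hr]) measurableSet_Ioi)
  rw [← key, ← integral_indicator measurableSet_Ioi]
  congr 1
  ext r
  by_cases hr : 0 < r
  · rw [Set.indicator_of_mem (Set.mem_Ioi.2 hr), hfexp r hr, Complex.real_smul]
  · rw [Set.indicator_of_notMem (by simpa using hr), hψ0 r (not_lt.1 hr), zero_smul]

/-! ### Transfer of integrability and the heat kernel identity -/

theorem exists_polyFun_ne_zero {d : ℕ} {V : MvPolynomial (Fin d) ℂ} (hV : V ≠ 0) :
    ∃ y : Euc d, polyFun V y ≠ 0 := by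
  by_contra! h
  apply hV
  refine MvPolynomial.funext_set (s := fun _ => Set.range (fun r : ℝ => (r : ℂ))) (fun i =>
    Set.infinite_range_of_injective Complex.ofReal_injective) fun z hz => ?_
  choose u hu using fun i => hz i (Set.mem_univ i)
  have := h (WithLp.toLp 2 u)
  have hz' : (fun i => ((u i : ℝ) : ℂ)) = z := funext hu
  simpa [polyFun, hz'] using this

theorem exists_polyFun_sphere_ne_zero {d l : ℕ} [Nontrivial (Euc d)]
    {V : MvPolynomial (Fin d) ℂ} (hl : V.IsHomogeneous l) (hV : V ≠ 0) :
    ∃ σ : Metric.sphere (0 : Euc d) 1, polyFun V σ.1 ≠ 0 := by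
  obtain ⟨y, hy⟩ := exists_polyFun_ne_zero hV
  obtain ⟨z, hz, hz0⟩ : ∃ z : Euc d, polyFun V z ≠ 0 ∧ z ≠ 0 := by
    by_cases h0 : y = 0
    -- If `V(0) ≠ 0`, then any `e` works, since `V(0) = 0^l V(e)`.
    · obtain ⟨e, he⟩ := exists_ne (0 : Euc d)
      refine ⟨e, fun h => hy ?_, he⟩
      rw [h0, ← zero_smul ℝ e, polyFun_smul hl, h, mul_zero]
    · exact ⟨y, hy, h0⟩
  refine ⟨⟨‖z‖⁻¹ • z, by simp [norm_smul, hz0]⟩, ?_⟩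
  simp only
  rw [polyFun_smul hl]
  refine mul_ne_zero (pow_ne_zero _ ?_) hz
  simpa using hz0

/-- By Fubini almost every ray carries an integrable restriction, and `V` is nonzero on a nonempty
open set of directions, which has positive measure. One direction with both properties isolates `φ`.
-/
theorem integrableOn_of_integrable_polyFun_mul {d l : ℕ} [Nontrivial (Euc d)]
    {V : MvPolynomial (Fin d) ℂ} (hl : V.IsHomogeneous l) (hV : V ≠ 0) {φ : ℝ → ℂ}
    (hi : Integrable fun y : Euc d => polyFun V y * φ ‖y‖) :
    IntegrableOn (fun r : ℝ => ((r ^ (d - 1 + l) : ℝ) : ℂ) * φ r) (Set.Ioi 0) := by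
  have h := (integrable_polar hi).prod_right_ae
  obtain ⟨σ₀, hσ₀⟩ := exists_polyFun_sphere_ne_zero hl hV
  have hopen : IsOpen {σ : Metric.sphere (0 : Euc d) 1 | polyFun V σ.1 ≠ 0} :=
    isOpen_ne_fun ((continuous_polyFun V).comp continuous_subtype_val) continuous_const
  have hpos := hopen.measure_ne_zero (volume : Measure (Euc d)).toSphere ⟨σ₀, hσ₀⟩
  have hfr : ∃ᵐ σ ∂(volume : Measure (Euc d)).toSphere, polyFun V σ.1 ≠ 0 :=
    frequently_ae_iff.2 hpos
  obtain ⟨σ, hσ, hσi⟩ := (hfr.and_eventually h).exists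
  have hn : ‖(σ : Euc d)‖ = 1 := by simp
  have hσi' : Integrable (fun r : Set.Ioi (0 : ℝ) => polyFun V (r.1 • σ.1) * φ ‖r.1 • σ.1‖)
      (Measure.volumeIoiPow (d - 1)) := hσi
  have e : ∀ r : Set.Ioi (0 : ℝ), polyFun V (r.1 • σ.1) * φ ‖r.1 • σ.1‖
      = polyFun V σ.1 * (((r.1 ^ l : ℝ) : ℂ) * φ r.1) := by
    intro r
    rw [polyFun_smul hl, norm_smul, hn, Real.norm_of_nonneg r.2.out.le, mul_one]
    push_cast
    ring
  simp only [e] at hσi'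
  have h1 := (integrable_const_mul_iff (isUnit_iff_ne_zero.2 hσ) _).1 hσi'
  have h2 := (integrableOn_volumeIoiPow_iff (g := fun r => ((r ^ l : ℝ) : ℂ) * φ r)).1 h1
  refine h2.congr_fun (fun r _ => ?_) measurableSet_Ioi
  simp only [pow_add]
  push_cast
  ring

theorem integrable_radial_iff {d : ℕ} [Nontrivial (Euc d)] {φ : ℝ → ℂ} :
    Integrable (fun y : Euc d => φ ‖y‖) ↔
      IntegrableOn (fun r : ℝ => ((r ^ (d - 1) : ℝ) : ℂ) * φ r) (Set.Ioi 0) := by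
  rw [integrable_fun_norm_addHaar (μ := volume), finrank_euclideanSpace_fin]
  simp only [Complex.real_smul]

/-- Change of weight: multiplication by the bounded quotient `u/w`. Measurability of `h` alone is
not needed. -/
theorem integrable_bdd_mul_weight {d : ℕ} {h : Euc d → ℂ} {w u : Euc d → ℝ} {C : ℝ}
    (hi : Integrable fun y => h y * (w y : ℂ)) (hw : ∀ᵐ y, 0 < w y) (hwm : Measurable w)
    (hum : Measurable u) (hu : ∀ᵐ y, |u y| ≤ C * w y) :
    Integrable fun y => h y * (u y : ℂ) := by
  have := hi.bdd_mul (c := C) (f := fun y => ((u y / w y : ℝ) : ℂ))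
    (Complex.measurable_ofReal.comp (hum.div hwm)).aestronglyMeasurable (by
      filter_upwards [hw, hu] with y hwy huy
      rw [Complex.norm_real, Real.norm_eq_abs, abs_div, abs_of_pos hwy, div_le_iff₀ hwy]
      exact huy)
  refine this.congr ?_
  filter_upwards [hw] with y hwy
  have : (w y : ℂ) ≠ 0 := Complex.ofReal_ne_zero.2 hwy.ne'
  push_cast
  field_simp

theorem measurable_weight {d : ℕ} (N : ℝ) : Measurable fun y : Euc d => (1 + ‖y‖) ^ N := by
  fun_prop

theorem weight_pos {d : ℕ} (N : ℝ) (y : Euc d) : 0 < (1 + ‖y‖) ^ N := by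
  have := norm_nonneg y
  positivity

theorem integrable_mul_gaussian {d : ℕ} {h : Euc d → ℂ} {N : ℝ}
    (hi : Integrable fun y => h y * (((1 + ‖y‖) ^ (-N) : ℝ) : ℂ)) {t : ℝ} (ht : 0 < t)
    (x : Euc d) : Integrable fun y => h y * (Real.exp (-t * ‖x - y‖ ^ 2) : ℂ) := by
  obtain ⟨C, _, hC⟩ := exists_exp_neg_mul_sq_le ht x N
  exact integrable_bdd_mul_weight hi (ae_of_all _ (weight_pos _)) (measurable_weight _)
    (by fun_prop) (ae_of_all _ fun y => by rw [abs_of_pos (Real.exp_pos _)]; exact hC y)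

/-- The radial density in dimension `d + 2l` is `r^{d-1+l} r^l`. The first factor is controlled by
integrability of `V φ`, the second by `r^l ≤ (1+r)^l`, so the weight exponent grows only by `l`. -/
theorem integrable_lift_weight {d l : ℕ} [Nontrivial (Euc d)] [Nontrivial (Euc (d + 2 * l))]
    {V : MvPolynomial (Fin d) ℂ} (hl : V.IsHomogeneous l) (hV : V ≠ 0) {φ : ℝ → ℂ} {N : ℝ}
    (hi : Integrable fun y : Euc d => polyFun V y * φ ‖y‖ * (((1 + ‖y‖) ^ (-N) : ℝ) : ℂ)) :
    Integrable fun y : Euc (d + 2 * l) => φ ‖y‖ * (((1 + ‖y‖) ^ (-(N + l)) : ℝ) : ℂ) := by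
  simp only [mul_assoc] at hi
  have h1 := integrableOn_of_integrable_polyFun_mul hl hV
    (φ := fun r => φ r * (((1 + r) ^ (-N) : ℝ) : ℂ)) hi
  refine (integrable_radial_iff (φ := fun r => φ r * (((1 + r) ^ (-(N + l)) : ℝ) : ℂ))).2 ?_
  have hd : 1 ≤ d := by
    by_contra h0
    obtain rfl : d = 0 := by omega
    exact not_subsingleton (Euc 0) inferInstance
  have h2 : IntegrableOn (fun r : ℝ => (((r / (1 + r)) ^ l : ℝ) : ℂ) *
      (((r ^ (d - 1 + l) : ℝ) : ℂ) * (φ r * (((1 + r) ^ (-N) : ℝ) : ℂ)))) (Set.Ioi 0) := by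
    refine Integrable.bdd_mul h1 (c := 1) (Measurable.aestronglyMeasurable (by fun_prop)) ?_
    rw [ae_restrict_iff' measurableSet_Ioi]
    refine ae_of_all _ fun r hr => ?_
    have hr' : 0 < r := hr
    rw [Complex.norm_real, Real.norm_of_nonneg (by positivity)]
    exact pow_le_one₀ (by positivity) ((div_le_one (by positivity)).2 (by linarith))
  refine h2.congr_fun (fun r hr => ?_) measurableSet_Ioi
  have hr' : 0 < r := hr
  have e1 : (1 + r) ^ (-(N + l)) = (1 + r) ^ (-N) / (1 + r) ^ l := by
    rw [neg_add, Real.rpow_add (by positivity), Real.rpow_neg (by positivity) (l : ℝ),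
      Real.rpow_natCast, div_eq_mul_inv]
  have e2 : r ^ (d + 2 * l - 1) = r ^ (d - 1 + l) * r ^ l := by
    rw [← pow_add]; congr 1; omega
  simp only [e1, e2, div_pow]
  push_cast
  ring

/-- The heat kernel intertwines multiplication by a solid harmonic with the dimension shift. -/
theorem integral_solidHarmonic_radial_mul_gaussian {d l : ℕ} [Nontrivial (Euc d)]
    [Nontrivial (Euc (d + 2 * l))] {V : MvPolynomial (Fin d) ℂ} (hV : IsSolidHarmonic V l)
    {φ : ℝ → ℂ} {N : ℝ}
    (hi : Integrable fun y : Euc d => polyFun V y * φ ‖y‖ * (((1 + ‖y‖) ^ (-N) : ℝ) : ℂ))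
    {x : Euc d} {x' : Euc (d + 2 * l)} (hx : ‖x'‖ = ‖x‖) {t : ℝ} (ht : 0 < t) :
    ∫ y : Euc d, polyFun V y * φ ‖y‖ * (Real.exp (-t * ‖x - y‖ ^ 2) : ℂ)
      = (((t / Real.pi) ^ l : ℝ) : ℂ) * polyFun V x *
        ∫ y : Euc (d + 2 * l), φ ‖y‖ * (Real.exp (-t * ‖x' - y‖ ^ 2) : ℂ) := by
  by_cases hV0 : V = 0
  · simp [hV0, polyFun]
  set c : ℂ := (((t / Real.pi) ^ l : ℝ) : ℂ) * polyFun V x with hc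
  set F : Euc d → ℂ := fun y => polyFun V y * (Real.exp (-t * ‖x - y‖ ^ 2) : ℂ) with hF
  set F' : Euc (d + 2 * l) → ℂ := fun y => (Real.exp (-t * ‖x' - y‖ ^ 2) : ℂ) with hF'
  have hFi : Integrable F := integrable_polyFun_mul_gaussian V ht x
  have hF'i : Integrable F' := by
    exact (integrable_polyFun_mul_gaussian (MvPolynomial.C 1) ht x').congr
      (ae_of_all _ fun y => by simp only [polyFun_C, one_mul, hF'])
  have hexp_i : ∀ {n : ℕ} {H : Euc n → ℂ} {s : ℝ}, 0 < s → Integrable H →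
      Integrable fun y => (Real.exp (-s * ‖y‖ ^ 2) : ℂ) * H y := by
    intro n H s hs hH
    refine hH.bdd_mul (c := 1) (Measurable.aestronglyMeasurable (by fun_prop))
      (ae_of_all _ fun y => ?_)
    rw [Complex.norm_real, Real.norm_of_nonneg (Real.exp_pos _).le]
    exact Real.exp_le_one_iff.2 (by nlinarith [sq_nonneg ‖y‖])
  have hexp_sphere : ∀ {n : ℕ} [Nontrivial (Euc n)] {H : Euc n → ℂ} {s : ℝ}, 0 < s →
      Integrable H → ∫ r in Set.Ioi 0, (Real.exp (-s * r ^ 2) : ℂ) * sphereIntegral H r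
        = ∫ y, (Real.exp (-s * ‖y‖ ^ 2) : ℂ) * H y := by
    intro n _ H s hs hH
    rw [integral_eq_integral_sphereIntegral (hexp_i hs hH)]
    refine setIntegral_congr_fun measurableSet_Ioi fun r hr => ?_
    exact (sphereIntegral_radial_mul (fun r => (Real.exp (-s * r ^ 2) : ℂ)) H hr).symm
  have hexp_s : ∀ {n : ℕ} [Nontrivial (Euc n)] {H : Euc n → ℂ} {s : ℝ}, 0 < s →
      Integrable H → IntegrableOn (fun r => (Real.exp (-s * r ^ 2) : ℂ) * sphereIntegral H r)
        (Set.Ioi 0) := by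
    intro n _ H s hs hH
    refine (integrableOn_sphereIntegral (hexp_i hs hH)).congr_fun (fun r hr => ?_)
      measurableSet_Ioi
    exact sphereIntegral_radial_mul (fun r => (Real.exp (-s * r ^ 2) : ℂ)) H hr
  -- For the profiles `e^{-s r²}` both sides are explicit Gaussian integrals; uniqueness of the
  -- Laplace transform then identifies the sphere integrals for almost every radius.
  have hae := ae_eq_zero_of_integral_exp_mul_eq_zero
    (g := fun r => sphereIntegral F r - c * sphereIntegral F' r)
    ((integrableOn_sphereIntegral hFi).sub ((integrableOn_sphereIntegral hF'i).const_mul c))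
    (fun s hs => by
      have h1 := integral_solidHarmonic_mul_gaussian hV x hs ht
      have h2 := integral_solidHarmonic_mul_gaussian (d := d + 2 * l) (l := 0)
        (V := MvPolynomial.C 1) ⟨MvPolynomial.isHomogeneous_C _ _, by simp⟩ x' hs ht
      simp only [mul_sub, mul_left_comm _ c]
      rw [integral_sub (hexp_s hs hFi) ((hexp_s hs hF'i).const_mul c), integral_const_mul,
        hexp_sphere hs hFi, hexp_sphere hs hF'i]
      have e1 : ∀ y, (Real.exp (-s * ‖y‖ ^ 2) : ℂ) * F y = polyFun V y *
          ((Real.exp (-s * ‖y‖ ^ 2) * Real.exp (-t * ‖x - y‖ ^ 2) : ℝ) : ℂ) := fun y => by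
        simp only [hF]; push_cast; ring
      have e2 : ∀ y, (Real.exp (-s * ‖y‖ ^ 2) : ℂ) * F' y = polyFun (MvPolynomial.C 1) y *
          ((Real.exp (-s * ‖y‖ ^ 2) * Real.exp (-t * ‖x' - y‖ ^ 2) : ℝ) : ℂ) := fun y => by
        simp only [hF', polyFun_C]; push_cast; ring
      simp only [e1, e2]
      rw [h1, h2, hx, polyFun_C, hc, sub_eq_zero]
      have e3 : ((d + 2 * l : ℕ) : ℝ) / 2 = (d : ℝ) / 2 + (l : ℝ) := by push_cast; ring
      have hst : 0 < s + t := by positivity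
      -- The `2l` extra dimensions supply `(π/(s+t))^l`, which removes `s` from the ratio; one
      -- constant `c` therefore serves all `s`.
      have e4 : (t / (s + t)) ^ l * (Real.pi / (s + t)) ^ ((d : ℝ) / 2)
          = (t / Real.pi) ^ l * (Real.pi / (s + t)) ^ (((d + 2 * l : ℕ) : ℝ) / 2) := by
        rw [e3, Real.rpow_add (by positivity), Real.rpow_natCast, div_pow, div_pow, div_pow]
        field_simp
      rw [e4]
      push_cast
      ring)
  have h1 := integrable_mul_gaussian hi ht x
  have h2 := integrable_mul_gaussian (integrable_lift_weight hV.1 hV0 hi) ht x'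
  have e1 : ∀ y : Euc d, polyFun V y * φ ‖y‖ * (Real.exp (-t * ‖x - y‖ ^ 2) : ℂ)
      = φ ‖y‖ * F y := fun y => by simp only [hF]; ring
  simp only [e1] at h1 ⊢
  rw [integral_eq_integral_sphereIntegral h1, integral_eq_integral_sphereIntegral h2,
    ← integral_const_mul]
  refine integral_congr_ae ?_
  filter_upwards [hae, ae_restrict_mem measurableSet_Ioi] with r hr hr0
  rw [sphereIntegral_radial_mul φ F hr0, sphereIntegral_radial_mul φ F' hr0, sub_eq_zero.1 hr]
  ring

/-! ### Powers of the distance as superpositions of Gaussians -/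

section Mellin

variable {n : ℕ} {H : Euc n → ℂ} {u : Euc n → ℝ} {β : ℝ}

theorem integrableOn_rpow_mul_exp {a b : ℝ} (ha : 0 < a) (hb : 0 < b) :
    IntegrableOn (fun t : ℝ => t ^ (a - 1) * Real.exp (-t * b)) (Set.Ioi 0) := by
  have := integrableOn_rpow_mul_exp_neg_mul_rpow (s := a - 1) (p := 1) (b := b) (by linarith)
    one_pos hb
  refine this.congr_fun (fun t _ => ?_) measurableSet_Ioi
  simp only [Real.rpow_one]
  congr 2; ring

theorem integral_rpow_mul_exp_sq {a r : ℝ} (ha : 0 < a) (hr : 0 < r) :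
    ∫ t in Set.Ioi (0 : ℝ), t ^ (a / 2 - 1) * Real.exp (-t * r ^ 2)
      = Real.Gamma (a / 2) * r ^ (-a) := by
  have h := Real.integral_rpow_mul_exp_neg_mul_Ioi (a := a / 2) (r := r ^ 2) (by positivity)
    (by positivity)
  rw [one_div, Real.inv_rpow (by positivity), ← Real.rpow_natCast r 2, ← Real.rpow_mul hr.le,
    ← Real.rpow_neg hr.le] at h
  rw [mul_comm, show -a = -(((2 : ℕ) : ℝ) * (a / 2)) by push_cast; ring, ← h]
  refine setIntegral_congr_fun measurableSet_Ioi fun t _ => ?_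
  simp [mul_comm]

/-- Tonelli with the `t`-integral done first. Both directions matter: one spreads a known kernel
integral over `t`, the other recovers convergence of the lifted kernel integral. -/
theorem integrable_mellin_iff (hH : AEStronglyMeasurable H) (hu : Measurable u)
    (hpos : ∀ᵐ y, 0 < u y) (hβ : 0 < β) :
    Integrable (fun p : ℝ × Euc n => ((p.1 ^ (β / 2 - 1) * Real.exp (-p.1 * u p.2 ^ 2) : ℝ) : ℂ)
      * H p.2) ((volume.restrict (Set.Ioi 0)).prod volume) ↔
    Integrable (fun y => H y * ((u y ^ (-β) : ℝ) : ℂ)) := by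
  have hm : AEStronglyMeasurable (fun p : ℝ × Euc n =>
      ((p.1 ^ (β / 2 - 1) * Real.exp (-p.1 * u p.2 ^ 2) : ℝ) : ℂ) * H p.2)
      ((volume.restrict (Set.Ioi 0)).prod volume) :=
    AEStronglyMeasurable.mul (Measurable.aestronglyMeasurable (by fun_prop)) hH.comp_snd
  have hG : Real.Gamma (β / 2) ≠ 0 := (Real.Gamma_pos_of_pos (by positivity)).ne'
  have hnorm : ∀ y, 0 < u y → ∫ t in Set.Ioi (0 : ℝ),
      ‖((t ^ (β / 2 - 1) * Real.exp (-t * u y ^ 2) : ℝ) : ℂ) * H y‖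
        = Real.Gamma (β / 2) * ‖H y * ((u y ^ (-β) : ℝ) : ℂ)‖ := by
    intro y hy
    have : ∀ t ∈ Set.Ioi (0 : ℝ), ‖((t ^ (β / 2 - 1) * Real.exp (-t * u y ^ 2) : ℝ) : ℂ) * H y‖
        = (t ^ (β / 2 - 1) * Real.exp (-t * u y ^ 2)) * ‖H y‖ := fun t ht => by
      have ht' : 0 < t := ht
      rw [norm_mul, Complex.norm_real, Real.norm_of_nonneg (by positivity)]
    rw [setIntegral_congr_fun measurableSet_Ioi this, integral_mul_const,
      integral_rpow_mul_exp_sq hβ hy, norm_mul, Complex.norm_real,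
      Real.norm_of_nonneg (by positivity)]
    ring
  rw [integrable_prod_iff' hm]
  have h1 : ∀ᵐ y : Euc n, Integrable (fun t : ℝ =>
      ((t ^ (β / 2 - 1) * Real.exp (-t * u y ^ 2) : ℝ) : ℂ) * H y)
      (volume.restrict (Set.Ioi 0)) := by
    filter_upwards [hpos] with y hy
    have hr : Integrable (fun t : ℝ => t ^ (β / 2 - 1) * Real.exp (-t * u y ^ 2))
      (volume.restrict (Set.Ioi 0)) :=
      integrableOn_rpow_mul_exp (a := β / 2) (by positivity) (pow_pos hy 2)
    exact hr.ofReal.mul_const _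
  have h2 : (fun y => ∫ t in Set.Ioi (0 : ℝ),
      ‖((t ^ (β / 2 - 1) * Real.exp (-t * u y ^ 2) : ℝ) : ℂ) * H y‖) =ᵐ[volume]
      fun y => Real.Gamma (β / 2) * ‖H y * ((u y ^ (-β) : ℝ) : ℂ)‖ := by
    filter_upwards [hpos] with y hy using hnorm y hy
  constructor
  · rintro ⟨_, h⟩
    have h3 := (integrable_congr h2).1 h
    have h4 := (integrable_const_mul_iff (isUnit_iff_ne_zero.2 hG) _).1 h3
    refine (integrable_norm_iff ?_).1 h4
    exact hH.mul (Measurable.aestronglyMeasurable (by fun_prop))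
  · intro h
    exact ⟨h1, (integrable_congr h2).2 (h.norm.const_mul _)⟩

theorem integral_mellin (hH : AEStronglyMeasurable H) (hu : Measurable u)
    (hpos : ∀ᵐ y, 0 < u y) (hβ : 0 < β)
    (hi : Integrable (fun y => H y * ((u y ^ (-β) : ℝ) : ℂ))) :
    (Real.Gamma (β / 2) : ℂ) * ∫ y, H y * ((u y ^ (-β) : ℝ) : ℂ)
      = ∫ t in Set.Ioi (0 : ℝ), ((t ^ (β / 2 - 1) : ℝ) : ℂ) *
        ∫ y, H y * (Real.exp (-t * u y ^ 2) : ℂ) := by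
  have hp := (integrable_mellin_iff hH hu hpos hβ).2 hi
  have h1 := integral_integral_swap (f := fun (t : ℝ) (y : Euc n) =>
    ((t ^ (β / 2 - 1) * Real.exp (-t * u y ^ 2) : ℝ) : ℂ) * H y) hp
  rw [← integral_const_mul]
  have h2 : ∀ t : ℝ, ((t ^ (β / 2 - 1) : ℝ) : ℂ) * ∫ y, H y * (Real.exp (-t * u y ^ 2) : ℂ)
      = ∫ y, ((t ^ (β / 2 - 1) * Real.exp (-t * u y ^ 2) : ℝ) : ℂ) * H y := by
    intro t
    rw [← integral_const_mul]
    refine integral_congr_ae (ae_of_all _ fun y => ?_)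
    simp only
    push_cast
    ring
  simp only [h2]
  rw [h1]
  refine integral_congr_ae ?_
  filter_upwards [hpos] with y hy
  rw [integral_mul_const, integral_complex_ofReal, integral_rpow_mul_exp_sq hβ hy]
  push_cast
  ring

end Mellin

theorem ae_norm_sub_pos {n : ℕ} [Nontrivial (Euc n)] (x : Euc n) : ∀ᵐ y : Euc n, 0 < ‖x - y‖ := by
  have : ({x} : Set (Euc n))ᶜ ∈ ae volume := compl_mem_ae_iff.2 (measure_singleton x)
  filter_upwards [this] with y hy
  rw [norm_pos_iff, sub_ne_zero]
  exact fun h => hy h.symm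

theorem one_add_norm_rpow_neg_le {n : ℕ} (x y : Euc n) {β : ℝ} (hβ : 0 < β) (h : 0 < ‖x - y‖) :
    (1 + ‖y‖) ^ (-β) ≤ (1 + ‖x‖) ^ β * ‖x - y‖ ^ (-β) := by
  have h1 : ‖x - y‖ ≤ (1 + ‖x‖) * (1 + ‖y‖) := by
    have := norm_sub_le x y
    nlinarith [norm_nonneg x, norm_nonneg y]
  have hx : 0 < 1 + ‖x‖ := by positivity
  have hy : 0 < 1 + ‖y‖ := by positivity
  rw [Real.rpow_neg hy.le, Real.rpow_neg h.le, ← div_eq_mul_inv, inv_eq_one_div,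
    div_le_div_iff₀ (by positivity) (by positivity), one_mul, ← Real.mul_rpow hx.le hy.le]
  exact Real.rpow_le_rpow h.le h1 hβ.le

/-- The singular kernel dominates a polynomial weight, which is the form of hypothesis in the
Gaussian identity. -/
theorem integrable_weight_of_kernel {n : ℕ} [Nontrivial (Euc n)] {h : Euc n → ℂ} {x : Euc n}
    {β : ℝ} (hβ : 0 < β) (hi : Integrable fun y => h y * ((‖x - y‖ ^ (-β) : ℝ) : ℂ)) :
    Integrable fun y => h y * (((1 + ‖y‖) ^ (-β) : ℝ) : ℂ) := by
  refine integrable_bdd_mul_weight (C := (1 + ‖x‖) ^ β) hi ?_ (by fun_prop)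
    (measurable_weight _) ?_
  · filter_upwards [ae_norm_sub_pos x] with y hy
    positivity
  · filter_upwards [ae_norm_sub_pos x] with y hy
    rw [abs_of_pos (weight_pos _ _)]
    exact one_add_norm_rpow_neg_le x y hβ hy

theorem aestronglyMeasurable_of_mul_weight {n : ℕ} {h : Euc n → ℂ} {N : ℝ}
    (hi : Integrable fun y => h y * (((1 + ‖y‖) ^ (-N) : ℝ) : ℂ)) : AEStronglyMeasurable h := by
  have h1 : AEStronglyMeasurable (fun y : Euc n => (((1 + ‖y‖) ^ N : ℝ) : ℂ)) :=
    Measurable.aestronglyMeasurable (by fun_prop)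
  refine (hi.aestronglyMeasurable.mul h1).congr (ae_of_all _ fun y => ?_)
  have : 0 < 1 + ‖y‖ := by positivity
  simp only [Pi.mul_apply]
  rw [mul_assoc, ← Complex.ofReal_mul, ← Real.rpow_add this]
  simp

/-- Multiplying `|V f w|` by the phase `V/|V|` keeps `V` itself while replacing `f` by `|f|`. The
Gaussian identity can then be used for the profile `|φ|`. -/
theorem integrable_polyFun_mul_norm {d : ℕ} {V : MvPolynomial (Fin d) ℂ} {f : Euc d → ℂ}
    {w : Euc d → ℝ} (hw : ∀ y, 0 ≤ w y)
    (hi : Integrable fun y => polyFun V y * f y * (w y : ℂ)) :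
    Integrable fun y => polyFun V y * (‖f y‖ : ℂ) * (w y : ℂ) := by
  have hm : Measurable (polyFun V : Euc d → ℂ) := (continuous_polyFun V).measurable
  have h := hi.norm.ofReal (𝕜 := ℂ)
  have := h.bdd_mul (c := 1) (f := fun y => polyFun V y / (‖polyFun V y‖ : ℂ))
    (Measurable.aestronglyMeasurable (hm.div (Complex.measurable_ofReal.comp hm.norm)))
    (ae_of_all _ fun y => by
      rw [norm_div, Complex.norm_real, norm_norm]
      exact div_self_le_one _)
  refine this.congr (ae_of_all _ fun y => ?_)
  by_cases h0 : polyFun V y = 0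
  · simp [h0]
  · have : (‖polyFun V y‖ : ℂ) ≠ 0 := by simpa using h0
    simp only [norm_mul, Complex.norm_real, Real.norm_of_nonneg (hw y)]
    push_cast
    simp only [Complex.coe_algebraMap]
    field_simp

theorem ofReal_integral_norm_kernel {n : ℕ} (φ : ℝ → ℂ) (x : Euc n) (a t : ℝ) (ht : 0 < t) :
    ((∫ y : Euc n, ‖((t ^ a * Real.exp (-t * ‖x - y‖ ^ 2) : ℝ) : ℂ) * φ ‖y‖‖ : ℝ) : ℂ)
      = ((t ^ a : ℝ) : ℂ) * ∫ y : Euc n, (‖φ ‖y‖‖ : ℂ) * (Real.exp (-t * ‖x - y‖ ^ 2) : ℂ) := by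
  rw [← integral_complex_ofReal, ← integral_const_mul]
  refine integral_congr_ae (ae_of_all _ fun y => ?_)
  simp only
  rw [norm_mul, Complex.norm_real, Real.norm_of_nonneg (by positivity)]
  push_cast
  ring

/-! ### Riesz potentials -/

section Riesz

variable {d l : ℕ} [Nontrivial (Euc d)] [Nontrivial (Euc (d + 2 * l))]
  {V : MvPolynomial (Fin d) ℂ} {φ : ℝ → ℂ} {x : Euc d} {x' : Euc (d + 2 * l)} {β : ℝ}

/-- The inner integral of absolute values in dimension `d + 2l` is, by the Gaussian identity for
`|φ|`, the inner integral of `V |φ|` in dimension `d` times `π^l / V(x)`. The latter is integrable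
in `t` by Fubini, so Tonelli applies. -/
theorem integrable_lift_kernel (hV : IsSolidHarmonic V l) (hx : ‖x'‖ = ‖x‖) (hβ : 0 < β)
    (hi : Integrable fun y => polyFun V y * φ ‖y‖ * ((‖x - y‖ ^ (-β) : ℝ) : ℂ))
    (hVx : polyFun V x ≠ 0) :
    Integrable fun y : Euc (d + 2 * l) => φ ‖y‖ * ((‖x' - y‖ ^ (-(β + 2 * l)) : ℝ) : ℂ) := by
  have hV0 : V ≠ 0 := fun h => hVx (by simp [h, polyFun])
  have hw := integrable_weight_of_kernel hβ hi
  have hw' := integrable_lift_weight hV.1 hV0 hw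
  have hm' := aestronglyMeasurable_of_mul_weight hw'
  have hin := integrable_polyFun_mul_norm (fun y => by positivity) hi
  have hwn := integrable_weight_of_kernel hβ hin
  have hmn := aestronglyMeasurable_of_mul_weight hwn
  rw [← integrable_mellin_iff hm' (u := fun y => ‖x' - y‖) (by fun_prop) (ae_norm_sub_pos x')
    (by positivity)]
  have hm : AEStronglyMeasurable (fun p : ℝ × Euc (d + 2 * l) =>
      ((p.1 ^ ((β + 2 * l) / 2 - 1) * Real.exp (-p.1 * ‖x' - p.2‖ ^ 2) : ℝ) : ℂ) * φ ‖p.2‖)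
      ((volume.restrict (Set.Ioi 0)).prod volume) :=
    AEStronglyMeasurable.mul (Measurable.aestronglyMeasurable (by fun_prop)) hm'.comp_snd
  refine (integrable_prod_iff hm).2 ⟨?_, ?_⟩
  · refine ae_restrict_of_forall_mem measurableSet_Ioi fun t ht => ?_
    refine ((integrable_mul_gaussian hw' ht x').const_mul
      ((t ^ ((β + 2 * l) / 2 - 1) : ℝ) : ℂ)).congr (ae_of_all _ fun y => ?_)
    simp only
    push_cast
    ring
  · have hp := (integrable_mellin_iff hmn (u := fun y => ‖x - y‖) (by fun_prop)
      (ae_norm_sub_pos x) hβ).2 hin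
    have hp1 := hp.integral_prod_left.const_mul ((((Real.pi ^ l : ℝ) : ℂ)) / polyFun V x)
    have hc : Integrable (fun t => ((∫ y : Euc (d + 2 * l), ‖((t ^ ((β + 2 * l) / 2 - 1)
        * Real.exp (-t * ‖x' - y‖ ^ 2) : ℝ) : ℂ) * φ ‖y‖‖ : ℝ) : ℂ))
        (volume.restrict (Set.Ioi 0)) := by
      refine hp1.congr ?_
      refine ae_restrict_of_forall_mem measurableSet_Ioi fun t ht => ?_
      have ht' : 0 < t := ht
      have key := integral_solidHarmonic_radial_mul_gaussian hV
        (φ := fun r => (‖φ r‖ : ℂ)) hwn hx ht'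
      have e1 : ∫ y : Euc d, ((t ^ (β / 2 - 1) * Real.exp (-t * ‖x - y‖ ^ 2) : ℝ) : ℂ) *
          (polyFun V y * (‖φ ‖y‖‖ : ℂ)) = ((t ^ (β / 2 - 1) : ℝ) : ℂ) *
          ∫ y : Euc d, polyFun V y * (‖φ ‖y‖‖ : ℂ) * (Real.exp (-t * ‖x - y‖ ^ 2) : ℂ) := by
        rw [← integral_const_mul]
        refine integral_congr_ae (ae_of_all _ fun y => ?_)
        simp only
        push_cast
        ring
      simp only [e1]
      rw [ofReal_integral_norm_kernel φ x' _ t ht', key]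
      -- The factor `t^l` of the Gaussian identity is what shifts `β` to `β + 2l`.
      have e2 : t ^ ((β + 2 * l) / 2 - 1) = t ^ (β / 2 - 1) * t ^ l := by
        rw [← Real.rpow_natCast, ← Real.rpow_add ht']
        congr 1; ring
      have hpi : (Real.pi : ℂ) ≠ 0 := Complex.ofReal_ne_zero.2 Real.pi_ne_zero
      rw [e2, div_pow]
      push_cast
      field_simp
    exact hc.re

theorem integral_solidHarmonic_radial_mul_kernel (hV : IsSolidHarmonic V l) (hx : ‖x'‖ = ‖x‖)
    (hβ : 0 < β) (hi : Integrable fun y => polyFun V y * φ ‖y‖ * ((‖x - y‖ ^ (-β) : ℝ) : ℂ)) :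
    (Real.Gamma (β / 2) : ℂ) * ∫ y, polyFun V y * φ ‖y‖ * ((‖x - y‖ ^ (-β) : ℝ) : ℂ)
      = (((Real.pi ^ l)⁻¹ : ℝ) : ℂ) * polyFun V x * ((Real.Gamma ((β + 2 * l) / 2) : ℂ) *
        ∫ y : Euc (d + 2 * l), φ ‖y‖ * ((‖x' - y‖ ^ (-(β + 2 * l)) : ℝ) : ℂ)) := by
  have hw := integrable_weight_of_kernel hβ hi
  have h1 := integral_mellin (aestronglyMeasurable_of_mul_weight hw) (u := fun y => ‖x - y‖)
    (by fun_prop) (ae_norm_sub_pos x) hβ hi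
  rw [h1]
  have key : ∀ t ∈ Set.Ioi (0 : ℝ), ((t ^ (β / 2 - 1) : ℝ) : ℂ) *
      ∫ y, polyFun V y * φ ‖y‖ * (Real.exp (-t * ‖x - y‖ ^ 2) : ℂ)
      = (((Real.pi ^ l)⁻¹ : ℝ) : ℂ) * polyFun V x * (((t ^ ((β + 2 * l) / 2 - 1) : ℝ) : ℂ) *
      ∫ y : Euc (d + 2 * l), φ ‖y‖ * (Real.exp (-t * ‖x' - y‖ ^ 2) : ℂ)) := by
    intro t ht
    have ht' : 0 < t := ht
    rw [integral_solidHarmonic_radial_mul_gaussian hV hw hx ht']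
    have e2 : t ^ ((β + 2 * l) / 2 - 1) = t ^ (β / 2 - 1) * t ^ l := by
      rw [← Real.rpow_natCast, ← Real.rpow_add ht']
      congr 1; ring
    rw [e2, div_pow]
    push_cast
    ring
  rw [setIntegral_congr_fun measurableSet_Ioi key, integral_const_mul]
  -- If `V(x) = 0`, both sides vanish whether or not the lifted integral converges.
  by_cases hVx : polyFun V x = 0
  · simp [hVx]
  have hV0 : V ≠ 0 := fun h => hVx (by simp [h, polyFun])
  rw [integral_mellin (aestronglyMeasurable_of_mul_weight (integrable_lift_weight hV.1 hV0 hw))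
    (u := fun y => ‖x' - y‖) (by fun_prop) (ae_norm_sub_pos x') (by positivity)
    (integrable_lift_kernel hV hx hβ hi hVx)]

end Riesz

theorem rieszIntegrand_sub {n : ℕ} (α : ℝ) (f : Euc n → ℂ) (x y : Euc n) :
    rieszIntegrand α f x (x - y) = f y * ((‖x - y‖ ^ (-((n : ℝ) - α)) : ℝ) : ℂ) := by
  rw [rieszIntegrand, sub_sub_cancel, Real.rpow_neg (norm_nonneg _), Complex.ofReal_inv,
    div_eq_mul_inv]

theorem rieszConverges_iff {n : ℕ} {α : ℝ} {f : Euc n → ℂ} {x : Euc n} :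
    RieszConverges α f x ↔
      Integrable fun y => f y * ((‖x - y‖ ^ (-((n : ℝ) - α)) : ℝ) : ℂ) := by
  rw [RieszConverges, ← integrable_comp_sub_left _ x]
  simp only [rieszIntegrand_sub]

theorem rieszPotential_eq {n : ℕ} (α : ℝ) (f : Euc n → ℂ) (x : Euc n) :
    rieszPotential α f x = ((1 / rieszGamma n α : ℝ) : ℂ) *
      ∫ y, f y * ((‖x - y‖ ^ (-((n : ℝ) - α)) : ℝ) : ℂ) := by
  rw [rieszPotential, ← integral_sub_left_eq_self _ volume x]
  simp only [rieszIntegrand_sub]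

/-- Take `β = d - α`; then `β + 2l` is the exponent in dimension `d + 2l`, and the Gamma quotient
with `π^l` is the ratio of the two `rieszGamma` constants. -/
theorem rieszPotential_solidHarmonic_radial {d l : ℕ} [Nontrivial (Euc d)]
    [Nontrivial (Euc (d + 2 * l))] {V : MvPolynomial (Fin d) ℂ} (hV : IsSolidHarmonic V l)
    {φ : ℝ → ℂ} {x : Euc d} {x' : Euc (d + 2 * l)} (hx : ‖x'‖ = ‖x‖) {α : ℝ} (hα : α < d)
    (hi : RieszConverges α (fun y => polyFun V y * φ ‖y‖) x) :
    (polyFun V x ≠ 0 → RieszConverges α (fun y : Euc (d + 2 * l) => φ ‖y‖) x') ∧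
    rieszPotential α (fun y => polyFun V y * φ ‖y‖) x
      = polyFun V x * rieszPotential α (fun y : Euc (d + 2 * l) => φ ‖y‖) x' := by
  have hβ : 0 < (d : ℝ) - α := by linarith
  have e : ((d + 2 * l : ℕ) : ℝ) - α = (d : ℝ) - α + 2 * l := by push_cast; ring
  rw [rieszConverges_iff] at hi
  rw [rieszConverges_iff, rieszPotential_eq, rieszPotential_eq, e]
  refine ⟨integrable_lift_kernel hV hx hβ hi, ?_⟩
  have h := integral_solidHarmonic_radial_mul_kernel hV hx hβ hi
  have hd : Real.pi ^ (((d + 2 * l : ℕ) : ℝ) / 2) = Real.pi ^ ((d : ℝ) / 2) * Real.pi ^ l := by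
    rw [← Real.rpow_natCast, ← Real.rpow_add Real.pi_pos]
    congr 1; push_cast; ring
  have r1 : 1 / rieszGamma d α = (2 ^ α * Real.pi ^ ((d : ℝ) / 2) * Real.Gamma (α / 2))⁻¹ *
      Real.Gamma (((d : ℝ) - α) / 2) := by
    rw [rieszGamma, one_div_div, div_eq_inv_mul]
  have r2 : 1 / rieszGamma (d + 2 * l) α
      = (2 ^ α * Real.pi ^ ((d : ℝ) / 2) * Real.Gamma (α / 2))⁻¹ * (Real.pi ^ l)⁻¹ *
      Real.Gamma (((d : ℝ) - α + 2 * l) / 2) := by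
    rw [rieszGamma, one_div_div, hd, e]
    simp only [div_eq_mul_inv, mul_inv]
    ring
  rw [r1, r2]
  simp only [Complex.ofReal_mul]
  rw [mul_assoc, h]
  ring

/-- At the origin the radial density times the kernel is `r^{α-1}` in every dimension. This covers
the case `V(0) = 0`, where the Gaussian argument gives no convergence. -/
theorem rieszConverges_lift_zero {d l : ℕ} [Nontrivial (Euc d)] [Nontrivial (Euc (d + 2 * l))]
    {φ : ℝ → ℂ} {α : ℝ}
    (hi : Integrable fun y : Euc d => φ ‖y‖ * ((‖y‖ ^ (α - (d : ℝ)) : ℝ) : ℂ)) :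
    RieszConverges α (fun y : Euc (d + 2 * l) => φ ‖y‖) 0 := by
  rw [rieszConverges_iff]
  simp only [zero_sub, norm_neg]
  have h1 := (integrable_radial_iff (φ := fun r => φ r * ((r ^ (α - (d : ℝ)) : ℝ) : ℂ))).1 hi
  refine (integrable_radial_iff
    (φ := fun r => φ r * ((r ^ (-(((d + 2 * l : ℕ) : ℝ) - α)) : ℝ) : ℂ))).2 ?_
  refine h1.congr_fun (fun r hr => ?_) measurableSet_Ioi
  have hr' : 0 < r := hr
  have hd : 1 ≤ d := by
    by_contra h0
    obtain rfl : d = 0 := by omega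
    exact not_subsingleton (Euc 0) inferInstance
  have e : r ^ (d - 1) * r ^ (α - (d : ℝ))
      = r ^ (d + 2 * l - 1) * r ^ (-(((d + 2 * l : ℕ) : ℝ) - α)) := by
    rw [← Real.rpow_natCast, ← Real.rpow_natCast, ← Real.rpow_add hr', ← Real.rpow_add hr',
      Nat.cast_sub hd, Nat.cast_sub (by omega)]
    congr 1; push_cast; ring
  have e' := congrArg (fun z : ℝ => (z : ℂ)) e
  simp only [Complex.ofReal_mul] at e'
  linear_combination φ r * e'

/-! ### Size of centered differences -/

/-- A `k`-th finite difference annihilates polynomials of degree below `k`. -/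
theorem centeredMoment_eq_zero {k i : ℕ} (h : i < k) :
    ∑ j ∈ Finset.range (k + 1), (-1 : ℝ) ^ j * (k.choose j : ℝ) * ((k : ℝ) / 2 - (j : ℝ)) ^ i
      = 0 := by
  have hP : ((Polynomial.C ((k : ℝ) / 2) - Polynomial.X) ^ i).natDegree < k := by
    refine lt_of_le_of_lt (Polynomial.natDegree_pow_le) (lt_of_le_of_lt ?_ h)
    have : (Polynomial.C ((k : ℝ) / 2) - Polynomial.X).natDegree ≤ 1 := by compute_degree
    nlinarith
  have h0 := congrFun (Polynomial.fwdDiff_iter_eq_zero_of_degree_lt hP) 0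
  rw [fwdDiff_iter_eq_sum_shift] at h0
  have h1 : (∑ j ∈ Finset.range (k + 1),
      (-1 : ℝ) ^ j * (k.choose j : ℝ) * ((k : ℝ) / 2 - (j : ℝ)) ^ i)
      = (-1) ^ k * ∑ j ∈ Finset.range (k + 1), ((-1 : ℤ) ^ (k - j) * (k.choose j : ℤ)) •
        ((Polynomial.C ((k : ℝ) / 2) - Polynomial.X) ^ i).eval ((0 : ℝ) + j • (1 : ℝ)) := by
    rw [Finset.mul_sum]
    refine Finset.sum_congr rfl fun j hj => ?_
    have hj' : j ≤ k := by
      have := Finset.mem_range.1 hj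
      omega
    have hs : (-1 : ℝ) ^ k * (-1) ^ (k - j) = (-1) ^ j := by
      rw [← pow_add, show k + (k - j) = j + 2 * (k - j) by omega, pow_add, pow_mul]
      simp
    rw [← hs]
    simp
    ring
  rw [h1, h0]
  simp

theorem exists_taylor_remainder_le {n m : ℕ} {h : Euc n → ℂ} {x : Euc n}
    (hh : ContDiffAt ℝ (m + 1 : ℕ) h x) :
    ∃ C δ : ℝ, 0 ≤ C ∧ 0 < δ ∧ ∀ v : Euc n, ‖v‖ < δ →
      ‖h (x + v) - ∑ i ∈ Finset.range (m + 1),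
        (i.factorial : ℝ)⁻¹ • iteratedFDeriv ℝ i h x (fun _ => v)‖ ≤ C * ‖v‖ ^ (m + 1) := by
  have hcont : ContinuousAt (iteratedFDeriv ℝ (m + 1) h) x :=
    (hh.iteratedFDeriv_right (m := 0) (i := m + 1) (by simp)).continuousAt
  -- A ball on which the top derivative exists and is bounded; segments issuing from its centre stay
  -- inside.
  have hev : ∀ᶠ z in 𝓝 x, ContDiffAt ℝ (m + 1 : ℕ) h z ∧
      ‖iteratedFDeriv ℝ (m + 1) h z‖ < ‖iteratedFDeriv ℝ (m + 1) h x‖ + 1 :=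
    (hh.eventually (by simp)).and (hcont.norm.eventually_lt_const (by linarith))
  obtain ⟨δ, hδ, hball⟩ := Metric.eventually_nhds_iff.1 hev
  refine ⟨‖iteratedFDeriv ℝ (m + 1) h x‖ + 1, δ, by positivity, hδ, fun v hv => ?_⟩
  have hseg : ∀ t ∈ Set.Icc (0 : ℝ) 1, dist (x + t • v) x < δ := by
    intro t ht
    rw [dist_self_add_left, norm_smul, Real.norm_of_nonneg ht.1]
    nlinarith [norm_nonneg v, ht.2]
  have hT := map_add_eq_sum_add_integral_iteratedFDeriv (f := h) (x := x) (y := v) (n := m)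
    fun t ht => by exact_mod_cast (hball (hseg t ht)).1
  rw [hT, add_sub_cancel_left, norm_smul, norm_inv, Real.norm_natCast]
  have hb : ‖∫ t in (0 : ℝ)..1, (1 - t) ^ m • iteratedFDeriv ℝ (m + 1) h (x + t • v) fun _ => v‖
      ≤ ((‖iteratedFDeriv ℝ (m + 1) h x‖ + 1) * ‖v‖ ^ (m + 1)) * |1 - 0| := by
    refine intervalIntegral.norm_integral_le_of_norm_le_const fun t ht => ?_
    rw [Set.uIoc_of_le zero_le_one] at ht
    have ht' : t ∈ Set.Icc (0 : ℝ) 1 := ⟨ht.1.le, ht.2⟩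
    rw [norm_smul, norm_pow, Real.norm_of_nonneg (by linarith [ht.2])]
    have h1 : (1 - t) ^ m ≤ 1 := pow_le_one₀ (by linarith [ht.2]) (by linarith [ht.1])
    have h2 := (iteratedFDeriv ℝ (m + 1) h (x + t • v)).le_opNorm (fun _ => v)
    simp only [Finset.prod_const, Finset.card_univ, Fintype.card_fin] at h2
    calc _ ≤ 1 * (‖iteratedFDeriv ℝ (m + 1) h (x + t • v)‖ * ‖v‖ ^ (m + 1)) := by gcongr
      _ ≤ _ := by
        rw [one_mul]
        gcongr
        exact (hball (hseg t ht')).2.le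
  rw [sub_zero, abs_one, mul_one] at hb
  refine le_trans (mul_le_of_le_one_left (norm_nonneg _) ?_) hb
  exact inv_le_one_of_one_le₀ (by exact_mod_cast m.factorial_pos)

/-- The vanishing moments remove the Taylor polynomial of degree below `k`, so only remainders of
order `|y|^k` are left. -/
theorem exists_centeredDiff_le {n k : ℕ} (hk : k ≠ 0) {h : Euc n → ℂ} {x : Euc n}
    (hh : ContDiffAt ℝ k h x) :
    ∃ C δ : ℝ, 0 ≤ C ∧ 0 < δ ∧ ∀ y : Euc n, ‖y‖ < δ → ‖centeredDiff k h x y‖ ≤ C * ‖y‖ ^ k := by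
  obtain ⟨m, rfl⟩ := Nat.exists_eq_succ_of_ne_zero hk
  obtain ⟨C, δ, hC, hδ, hT⟩ := exists_taylor_remainder_le hh
  set k := m.succ with hkdef
  have hk0 : 0 < (k : ℝ) := by rw [hkdef]; positivity
  set R : Euc n → ℂ := fun v => h (x + v) - ∑ i ∈ Finset.range (m + 1),
    (i.factorial : ℝ)⁻¹ • iteratedFDeriv ℝ i h x (fun _ => v) with hR
  have hsum : ∀ y, centeredDiff k h x y = ∑ j ∈ Finset.range (k + 1),
      (-1 : ℂ) ^ j * (k.choose j : ℂ) * R (((k : ℝ) / 2 - (j : ℝ)) • y) := by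
    intro y
    have hz : ∑ j ∈ Finset.range (k + 1), (-1 : ℂ) ^ j * (k.choose j : ℂ) *
        ∑ i ∈ Finset.range (m + 1), (i.factorial : ℝ)⁻¹ •
          iteratedFDeriv ℝ i h x (fun _ => ((k : ℝ) / 2 - (j : ℝ)) • y) = 0 := by
      simp only [Finset.mul_sum]
      rw [Finset.sum_comm]
      refine Finset.sum_eq_zero fun i hi => ?_
      have hi' : i < k := Finset.mem_range.1 hi
      have hmom := congrArg (fun r : ℝ => (r : ℂ)) (centeredMoment_eq_zero hi')
      simp only [Complex.ofReal_zero] at hmom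
      rw [← mul_zero ((i.factorial : ℝ)⁻¹ • iteratedFDeriv ℝ i h x (fun _ => y)), ← hmom]
      push_cast
      rw [Finset.mul_sum]
      refine Finset.sum_congr rfl fun j _ => ?_
      rw [(iteratedFDeriv ℝ i h x).map_smul_univ (fun _ => (k : ℝ) / 2 - (j : ℝ)) (fun _ => y)]
      simp only [Finset.prod_const, Finset.card_univ, Fintype.card_fin, Complex.real_smul]
      push_cast
      ring
    rw [centeredDiff, ← sub_zero (∑ j ∈ Finset.range (k + 1), _), ← hz, ← Finset.sum_sub_distrib]
    refine Finset.sum_congr rfl fun j _ => ?_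
    rw [hR]
    ring
  -- The shifts satisfy `|k/2 - j| ≤ k`, whence the radius `δ/k` and the factor `k^k`.
  refine ⟨∑ j ∈ Finset.range (k + 1), (k.choose j : ℝ) * (C * (k : ℝ) ^ k), δ / k,
    by positivity, by positivity, fun y hy => ?_⟩
  rw [hsum, Finset.sum_mul]
  refine norm_sum_le_of_le _ fun j hj => ?_
  have hj' : (j : ℝ) ≤ k := by
    have := Finset.mem_range.1 hj
    exact_mod_cast Nat.lt_succ_iff.1 this
  have hc : |(k : ℝ) / 2 - j| ≤ k := by
    rw [abs_le]; constructor <;> linarith [(j.cast_nonneg : (0 : ℝ) ≤ j)]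
  have hv : ‖((k : ℝ) / 2 - (j : ℝ)) • y‖ ≤ k * ‖y‖ := by
    rw [norm_smul, Real.norm_eq_abs]
    gcongr
  have hv' : ‖((k : ℝ) / 2 - (j : ℝ)) • y‖ < δ := by
    rw [lt_div_iff₀ hk0] at hy
    linarith
  rw [norm_mul, norm_mul, norm_pow, norm_neg, norm_one, one_pow, one_mul, Complex.norm_natCast]
  rw [mul_assoc, mul_assoc, ← mul_pow]
  gcongr
  exact (hT _ hv').trans (by gcongr)

/-! ### The fractional integral and its independence of `k` -/

/-- Integrability at infinity, and vanishing of the centered differences at `x` to full order. -/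
structure FracAdmissible {n : ℕ} (α : ℝ) (h : Euc n → ℂ) (x : Euc n) : Prop where
  integrable_weight : Integrable fun y => h y * (((1 + ‖y‖) ^ (-(α + n)) : ℝ) : ℂ)
  centeredDiff_le : ∀ k : ℕ, k ≠ 0 → ∃ C δ : ℝ, 0 ≤ C ∧ 0 < δ ∧ ∀ y : Euc n, ‖y‖ < δ →
    ‖centeredDiff k h x y‖ ≤ C * ‖y‖ ^ k

section

variable {n : ℕ} {α : ℝ} {h : Euc n → ℂ} {x : Euc n}

theorem FracAdmissible.mono {β : ℝ} (ha : FracAdmissible α h x) (hβ : α ≤ β) :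
    FracAdmissible β h x := by
  refine ⟨integrable_bdd_mul_weight (C := 1) ha.integrable_weight
    (ae_of_all _ (weight_pos _)) (measurable_weight _) (measurable_weight _)
    (ae_of_all _ fun y => ?_), ha.centeredDiff_le⟩
  rw [abs_of_pos (weight_pos _ _), one_mul]
  exact Real.rpow_le_rpow_of_exponent_le (by linarith [norm_nonneg y]) (by linarith)

theorem integrable_comp_affine_mul_weight (hα : 0 < α)
    (hi : Integrable fun y => h y * (((1 + ‖y‖) ^ (-(α + n)) : ℝ) : ℂ)) (x : Euc n) (c : ℝ) :
    Integrable fun y : Euc n => h (x + c • y) * (((1 + ‖y‖) ^ (-(α + n)) : ℝ) : ℂ) := by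
  -- The central node of the difference gives the constant `h(x)`; the weight alone is integrable
  -- because `α > 0`.
  by_cases hc : c = 0
  · simp only [hc, zero_smul, add_zero]
    refine Integrable.const_mul ?_ _
    exact (integrable_one_add_norm (by simp [hα])).ofReal
  have h1 : Integrable fun y : Euc n =>
      h (x + c • y) * (((1 + ‖x + c • y‖) ^ (-(α + n)) : ℝ) : ℂ) := by
    have := (hi.comp_add_left x).comp_smul hc
    exact this
  have hαn : 0 < α + n := by positivity
  refine integrable_bdd_mul_weight (C := (1 + ‖x‖ + |c|) ^ (α + n)) h1
    (ae_of_all _ fun y => by positivity) (by fun_prop) (measurable_weight _)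
    (ae_of_all _ fun y => ?_)
  rw [abs_of_pos (weight_pos _ _), Real.rpow_neg (by positivity), Real.rpow_neg (by positivity),
    ← div_eq_mul_inv, inv_eq_one_div, div_le_div_iff₀ (by positivity) (by positivity), one_mul,
    ← Real.mul_rpow (by positivity) (by positivity)]
  refine Real.rpow_le_rpow (by positivity) ?_ hαn.le
  have h2 : ‖x + c • y‖ ≤ ‖x‖ + |c| * ‖y‖ := by
    refine (norm_add_le _ _).trans_eq ?_
    rw [norm_smul, Real.norm_eq_abs]
  nlinarith [norm_nonneg x, norm_nonneg y, abs_nonneg c, mul_nonneg (norm_nonneg x) (norm_nonneg y)]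

theorem integrable_centeredDiff_mul_weight (hα : 0 < α)
    (hi : Integrable fun y => h y * (((1 + ‖y‖) ^ (-(α + n)) : ℝ) : ℂ)) (x : Euc n) (k : ℕ) :
    Integrable fun y : Euc n => centeredDiff k h x y * (((1 + ‖y‖) ^ (-(α + n)) : ℝ) : ℂ) := by
  simp only [centeredDiff, Finset.sum_mul]
  refine integrable_finsetSum _ fun j _ => ?_
  simp only [mul_assoc]
  exact ((integrable_comp_affine_mul_weight hα hi x _).const_mul _).const_mul _

theorem fracIntegrand_eq (k : ℕ) (y : Euc n) :
    fracIntegrand α k h x y = -(centeredDiff k h x y * ((‖y‖ ^ (-(α + n)) : ℝ) : ℂ)) := by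
  rw [fracIntegrand, Real.rpow_neg (norm_nonneg _), add_comm α]
  push_cast
  ring

theorem integrableOn_fracIntegrand_compl_ball (hα : 0 < α)
    (hi : Integrable fun y => h y * (((1 + ‖y‖) ^ (-(α + n)) : ℝ) : ℂ)) (x : Euc n) (k : ℕ)
    {ε : ℝ} (hε : 0 < ε) :
    IntegrableOn (fracIntegrand α k h x) (Metric.ball (0 : Euc n) ε)ᶜ := by
  have h1 := integrable_centeredDiff_mul_weight hα hi x k
  have hαn : 0 < α + n := by positivity
  have hms : MeasurableSet (Metric.ball (0 : Euc n) ε)ᶜ := measurableSet_ball.compl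
  -- For `|y| ≥ ε` one has `1 + |y| ≤ (1/ε + 1)|y|`.
  have h2 := integrable_bdd_mul_weight (C := (1 / ε + 1) ^ (α + n))
    (u := (Metric.ball (0 : Euc n) ε)ᶜ.indicator fun y => ‖y‖ ^ (-(α + n))) h1
    (ae_of_all _ (weight_pos _)) (measurable_weight _)
    (Measurable.indicator (by fun_prop) hms) (ae_of_all _ fun y => by
      by_cases hy : y ∈ (Metric.ball (0 : Euc n) ε)ᶜ
      · rw [Set.indicator_of_mem hy]
        have hy' : ε ≤ ‖y‖ := by simpa using hy
        have hy0 : 0 < ‖y‖ := hε.trans_le hy'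
        rw [abs_of_pos (by positivity), Real.rpow_neg (by positivity),
          Real.rpow_neg (by positivity), ← div_eq_mul_inv, inv_eq_one_div,
          div_le_div_iff₀ (by positivity) (by positivity), one_mul,
          ← Real.mul_rpow (by positivity) (by positivity)]
        refine Real.rpow_le_rpow (by positivity) ?_ hαn.le
        have : 1 ≤ 1 / ε * ‖y‖ := by
          rw [one_div, inv_mul_eq_div, le_div_iff₀ hε]; linarith
        linarith
      · rw [Set.indicator_of_notMem hy, abs_zero]
        positivity)
  refine (h2.neg.integrableOn (s := (Metric.ball (0 : Euc n) ε)ᶜ)).congr_fun (fun y hy => ?_) hms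
  simp only [Pi.neg_apply]
  rw [fracIntegrand_eq, Set.indicator_of_mem hy]

theorem integrableOn_norm_rpow_ball {n : ℕ} [Nontrivial (Euc n)] {s : ℝ} (hs : -(n : ℝ) < s)
    (δ : ℝ) : IntegrableOn (fun y : Euc n => ‖y‖ ^ s) (Metric.ball 0 δ) := by
  rcases le_or_gt δ 0 with hδ | hδ
  · rw [Metric.ball_eq_empty.2 hδ]; exact integrableOn_empty
  refine (integrableOn_fun_norm_addHaar volume (f := fun r : ℝ => r ^ s)).2 ?_
  rw [finrank_euclideanSpace_fin]
  have hn : 1 ≤ n := by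
    by_contra h0
    obtain rfl : n = 0 := by omega
    exact not_subsingleton (Euc 0) inferInstance
  have h1 := (intervalIntegral.integrableOn_Ioo_rpow_iff (s := (n : ℝ) - 1 + s) hδ).2 (by linarith)
  refine h1.congr_fun (fun r hr => ?_) measurableSet_Ioo
  simp only [smul_eq_mul]
  rw [Real.rpow_add hr.1, ← Real.rpow_natCast, Nat.cast_sub hn, Nat.cast_one]

/-- Near the origin the integrand is `O(|y|^{k-α-n})` with `k > α`, so no cancellation is needed and
the truncated integrals converge to a genuine integral. -/
theorem FracAdmissible.integrable_fracIntegrand [Nontrivial (Euc n)] (ha : FracAdmissible α h x)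
    (hα : 0 < α) {k : ℕ} (hk : α < k) : Integrable (fracIntegrand α k h x) := by
  have hk0 : k ≠ 0 := by
    rintro rfl
    simp at hk
    linarith
  obtain ⟨C, δ, hC, hδ, hb⟩ := ha.centeredDiff_le k hk0
  rw [← integrableOn_univ, ← Set.union_compl_self (Metric.ball (0 : Euc n) δ)]
  refine IntegrableOn.union ?_
    (integrableOn_fracIntegrand_compl_ball hα ha.integrable_weight x k hδ)
  have hm : AEStronglyMeasurable (fracIntegrand α k h x) := by
    have h1 := aestronglyMeasurable_of_mul_weight
      (integrable_centeredDiff_mul_weight hα ha.integrable_weight x k)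
    have h2 : AEStronglyMeasurable fun y : Euc n => ((‖y‖ ^ (-(α + n)) : ℝ) : ℂ) :=
      Measurable.aestronglyMeasurable (by fun_prop)
    exact (h1.mul h2).neg.congr (ae_of_all _ fun y => (fracIntegrand_eq k y).symm)
  have hmaj : IntegrableOn (fun y : Euc n => C * ‖y‖ ^ ((k : ℝ) - (α + n))) (Metric.ball 0 δ) :=
    (integrableOn_norm_rpow_ball (by linarith) δ).const_mul C
  refine hmaj.mono' hm.restrict ?_
  have hne : ∀ᵐ y : Euc n, 0 < ‖y‖ := by simpa using ae_norm_sub_pos (0 : Euc n)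
  filter_upwards [ae_restrict_mem measurableSet_ball, ae_restrict_of_ae hne] with y hy hy0
  have hy' : ‖y‖ < δ := by simpa using hy
  rw [fracIntegrand_eq, norm_neg, norm_mul, Complex.norm_real,
    Real.norm_of_nonneg (by positivity), sub_eq_add_neg, Real.rpow_add hy0, Real.rpow_natCast,
    ← mul_assoc]
  gcongr
  exact hb y hy'

theorem tendsto_setIntegral_compl_ball {n : ℕ} [Nontrivial (Euc n)] {F : Euc n → ℂ}
    (hF : Integrable F) :
    Tendsto (fun ε : ℝ => ∫ y in (Metric.ball (0 : Euc n) ε)ᶜ, F y) (𝓝[>] 0) (𝓝 (∫ y, F y)) := by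
  simp only [← integral_indicator measurableSet_ball.compl]
  refine tendsto_integral_filter_of_dominated_convergence (fun y => ‖F y‖) ?_ ?_ hF.norm ?_
  · exact Eventually.of_forall fun ε => hF.aestronglyMeasurable.indicator measurableSet_ball.compl
  · exact Eventually.of_forall fun ε => ae_of_all _ fun y => norm_indicator_le_norm_self _ _
  · have hne : ∀ᵐ y : Euc n, 0 < ‖y‖ := by simpa using ae_norm_sub_pos (0 : Euc n)
    filter_upwards [hne] with y hy
    refine tendsto_const_nhds.congr' ?_
    filter_upwards [mem_nhdsWithin_of_mem_nhds (Iio_mem_nhds hy)] with ε hε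
    rw [Set.indicator_of_mem]
    simpa using (Set.mem_Iio.1 hε).le

/-- The untruncated integral of the fractional Laplacian. -/
noncomputable def fracInt (α : ℝ) (k : ℕ) (h : Euc n → ℂ) (x : Euc n) : ℂ :=
  ∫ y, fracIntegrand α k h x y

/-- The alternating sum in `chiFormula`. -/
noncomputable def chiSum (k : ℕ) (β : ℝ) : ℝ :=
  ∑ j ∈ Finset.range (k + 1), (-1 : ℝ) ^ j * (k.choose j : ℝ) * |(k : ℝ) / 2 - (j : ℝ)| ^ β

theorem centeredDiff_zero_right {k : ℕ} (hk : k ≠ 0) : centeredDiff k h x 0 = 0 := by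
  have := congrArg (fun r : ℝ => (r : ℂ)) (centeredMoment_eq_zero (Nat.pos_of_ne_zero hk))
  simp only [pow_zero, mul_one] at this
  push_cast at this
  simp only [centeredDiff, smul_zero, add_zero]
  rw [← Finset.sum_mul, this, zero_mul]

/-- The change of variables `y ↦ c y` against a kernel homogeneous of degree `-(α+n)` leaves
`|c|^α`. These powers add up to `chiSum`. -/
theorem scaled_fracIntegrand [Nontrivial (Euc n)] (ha : FracAdmissible α h x)
    (hα : 0 < α) {k : ℕ} (hk : α < k) (c : ℝ) :
    Integrable (fun y => centeredDiff k h x (c • y) * ((‖y‖ ^ (-(α + n)) : ℝ) : ℂ)) ∧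
    ∫ y, centeredDiff k h x (c • y) * ((‖y‖ ^ (-(α + n)) : ℝ) : ℂ)
      = -(((|c| ^ α : ℝ) : ℂ) * fracInt α k h x) := by
  have hk0 : k ≠ 0 := by
    rintro rfl
    simp at hk
    linarith
  by_cases hc : c = 0
  · simp [hc, centeredDiff_zero_right hk0, Real.zero_rpow hα.ne']
  have hc' : 0 < |c| := abs_pos.2 hc
  have e : ∀ y, centeredDiff k h x (c • y) * ((‖y‖ ^ (-(α + n)) : ℝ) : ℂ)
      = ((-|c| ^ (α + n) : ℝ) : ℂ) * fracIntegrand α k h x (c • y) := by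
    intro y
    have : |c| ^ (α + n) * |c| ^ (-(α + n)) = 1 := by
      rw [← Real.rpow_add hc']; simp
    have h2 := congrArg (fun r : ℝ => (r : ℂ)) this
    simp only [Complex.ofReal_mul, Complex.ofReal_one] at h2
    rw [fracIntegrand_eq, norm_smul, Real.norm_eq_abs, Real.mul_rpow hc'.le (norm_nonneg _)]
    push_cast
    linear_combination -(centeredDiff k h x (c • y) * ((‖y‖ ^ (-(α + n)) : ℝ) : ℂ)) * h2
  have hi := ha.integrable_fracIntegrand hα hk
  simp only [e]
  refine ⟨(hi.comp_smul hc).const_mul _, ?_⟩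
  rw [integral_const_mul, Measure.integral_comp_smul, finrank_euclideanSpace_fin, fracInt,
    Complex.real_smul, ← mul_assoc, ← Complex.ofReal_mul, abs_inv, abs_pow,
    Real.rpow_add hc', Real.rpow_natCast]
  have : |c| ^ n ≠ 0 := by positivity
  rw [show -(|c| ^ α * |c| ^ n) * (|c| ^ n)⁻¹ = -|c| ^ α by field_simp]
  push_cast
  ring

/-- Both sides sample `h` at the points `x + (k'/2 - i)(k/2 - j) y` with the same coefficients. -/
theorem sum_centeredDiff_symm (k k' : ℕ) (h : Euc n → ℂ) (x y : Euc n) :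
    ∑ i ∈ Finset.range (k' + 1), (-1 : ℂ) ^ i * (k'.choose i : ℂ) *
        centeredDiff k h x (((k' : ℝ) / 2 - (i : ℝ)) • y)
      = ∑ j ∈ Finset.range (k + 1), (-1 : ℂ) ^ j * (k.choose j : ℂ) *
        centeredDiff k' h x (((k : ℝ) / 2 - (j : ℝ)) • y) := by
  simp only [centeredDiff, Finset.mul_sum]
  rw [Finset.sum_comm]
  refine Finset.sum_congr rfl fun j _ => Finset.sum_congr rfl fun i _ => ?_
  rw [smul_smul, smul_smul, mul_comm ((k : ℝ) / 2 - j)]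
  ring

theorem integral_sum_centeredDiff [Nontrivial (Euc n)] (ha : FracAdmissible α h x)
    (hα : 0 < α) {k : ℕ} (hk : α < k) (k' : ℕ) :
    ∫ y, (∑ i ∈ Finset.range (k' + 1), (-1 : ℂ) ^ i * (k'.choose i : ℂ) *
        centeredDiff k h x (((k' : ℝ) / 2 - (i : ℝ)) • y)) * ((‖y‖ ^ (-(α + n)) : ℝ) : ℂ)
      = -((chiSum k' α : ℂ) * fracInt α k h x) := by
  simp only [Finset.sum_mul, mul_assoc]
  rw [integral_finsetSum _ fun i _ =>
    (((scaled_fracIntegrand ha hα hk _).1).const_mul _).const_mul _]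
  simp only [integral_const_mul, (scaled_fracIntegrand ha hα hk _).2, chiSum]
  push_cast
  rw [Finset.sum_mul, ← Finset.sum_neg_distrib]
  refine Finset.sum_congr rfl fun i _ => ?_
  ring

/-- The integral of the iterated difference is evaluated in both orders. At even integers both sums
vanish and the relation is empty, hence the limit in `chi_mul_fracInt`. -/
theorem chiSum_mul_fracInt [Nontrivial (Euc n)] (ha : FracAdmissible α h x)
    (hα : 0 < α) {k k' : ℕ} (hk : α < k) (hk' : α < k') :
    (chiSum k' α : ℂ) * fracInt α k h x = (chiSum k α : ℂ) * fracInt α k' h x := by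
  have h1 := integral_sum_centeredDiff ha hα hk k'
  have h2 := integral_sum_centeredDiff ha hα hk' k
  simp only [sum_centeredDiff_symm k k'] at h1
  exact neg_injective (h1.symm.trans h2)

theorem tendsto_fracInt [Nontrivial (Euc n)] (ha : FracAdmissible α h x)
    (hα : 0 < α) {k : ℕ} (hk : α < k) :
    Tendsto (fun β => fracInt β k h x) (𝓝[>] α) (𝓝 (fracInt α k h x)) := by
  -- An exponent strictly between `α` and `k`: the integrand at `γ` dominates near the origin and
  -- the one at `α` dominates at infinity. Only `β > α` is used, as integrability at infinity is
  -- known only there.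
  set γ := (α + k) / 2 with hγ
  have h1 : α < γ := by rw [hγ]; linarith
  have h2 : γ < k := by rw [hγ]; linarith
  have hev : ∀ᶠ β in 𝓝[>] α, α < β ∧ β < γ := by
    filter_upwards [self_mem_nhdsWithin, mem_nhdsWithin_of_mem_nhds (Iio_mem_nhds h1)] with β a b
    exact ⟨a, b⟩
  refine tendsto_integral_filter_of_dominated_convergence
    (fun y => ‖fracIntegrand α k h x y‖ + ‖fracIntegrand γ k h x y‖) ?_ ?_
    ((ha.integrable_fracIntegrand hα hk).norm.add
      ((ha.mono h1.le).integrable_fracIntegrand (hα.trans h1) h2).norm) ?_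
  · filter_upwards [hev] with β hβ
    exact ((ha.mono hβ.1.le).integrable_fracIntegrand (hα.trans hβ.1)
      (hβ.2.trans h2)).aestronglyMeasurable
  · have hne : ∀ᵐ y : Euc n, 0 < ‖y‖ := by simpa using ae_norm_sub_pos (0 : Euc n)
    filter_upwards [hev] with β hβ
    filter_upwards [hne] with y hy
    simp only [fracIntegrand_eq, norm_neg, norm_mul, Complex.norm_real]
    rw [← mul_add]
    refine mul_le_mul_of_nonneg_left ?_ (norm_nonneg _)
    rw [Real.norm_of_nonneg (by positivity), Real.norm_of_nonneg (by positivity),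
      Real.norm_of_nonneg (by positivity)]
    have p1 : 0 < ‖y‖ ^ (-(α + n)) := by positivity
    have p2 : 0 < ‖y‖ ^ (-(γ + n)) := by positivity
    rcases le_total ‖y‖ 1 with hy1 | hy1
    · have := Real.rpow_le_rpow_of_exponent_ge hy hy1 (y := -(β + n)) (z := -(γ + n))
        (by linarith [hβ.2])
      linarith
    · have := Real.rpow_le_rpow_of_exponent_le hy1 (y := -(β + n)) (z := -(α + n))
        (by linarith [hβ.1])
      linarith
  · have hne : ∀ᵐ y : Euc n, 0 < ‖y‖ := by simpa using ae_norm_sub_pos (0 : Euc n)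
    filter_upwards [hne] with y hy
    simp only [fracIntegrand_eq]
    refine ContinuousAt.tendsto (f := fun β : ℝ =>
      -(centeredDiff k h x y * ((‖y‖ ^ (-(β + n)) : ℝ) : ℂ))) ?_ |>.mono_left nhdsWithin_le_nhds
    have hc : ContinuousAt (fun β : ℝ => ‖y‖ ^ (-(β + n))) α :=
      ContinuousAt.rpow continuousAt_const (by fun_prop) (Or.inl hy.ne')
    exact (continuousAt_const.mul (Complex.continuous_ofReal.continuousAt.comp hc)).neg

/-- Multiply `chiSum_mul_fracInt` at `β > α` by `-γ_n(-β)` and let `β` decrease to `α`; the limit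
also covers even `α`. -/
theorem chi_mul_fracInt [Nontrivial (Euc n)] (ha : FracAdmissible α h x)
    (hα : 0 < α) {k k' : ℕ} (hk : α < k) (hk' : α < k') :
    (chi n k' α : ℂ) * fracInt α k h x = (chi n k α : ℂ) * fracInt α k' h x := by
  have hle : 𝓝[>] α ≤ 𝓝[≠] α := nhdsWithin_mono _ fun β hβ => ne_of_gt hβ
  have t1 := ((Complex.continuous_ofReal.tendsto _).comp
    ((tendsto_chiFormula n k' hα hk').mono_left hle)).mul (tendsto_fracInt ha hα hk)
  have t2 := ((Complex.continuous_ofReal.tendsto _).comp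
    ((tendsto_chiFormula n k hα hk).mono_left hle)).mul (tendsto_fracInt ha hα hk')
  refine tendsto_nhds_unique (t1.congr' ?_) t2
  filter_upwards [self_mem_nhdsWithin, mem_nhdsWithin_of_mem_nhds (Iio_mem_nhds hk),
    mem_nhdsWithin_of_mem_nhds (Iio_mem_nhds hk')] with β h1 h2 h3
  have h1' : α < β := h1
  have := chiSum_mul_fracInt (ha.mono h1'.le) (hα.trans h1') h2 h3
  have e : ∀ m : ℕ, chiFormula n m β = -rieszGamma n (-β) * chiSum m β := fun m => rfl
  simp only [Function.comp, e]
  push_cast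
  linear_combination -(rieszGamma n (-β) : ℂ) * this

theorem FracAdmissible.hasFracLaplacian [Nontrivial (Euc n)] (ha : FracAdmissible α h x)
    (hα : 0 < α) (hchi : ∀ k : ℕ, Even k → α < k → chi n k α ≠ 0) {k : ℕ} (hke : Even k)
    (hk : α < k) :
    HasFracLaplacian α h x (((1 / chi n k α : ℝ) : ℂ) * fracInt α k h x) := by
  intro k' hke' hk'
  refine ⟨fun ε hε => integrableOn_fracIntegrand_compl_ball hα ha.integrable_weight x k' hε, ?_⟩
  have e : ((1 / chi n k α : ℝ) : ℂ) * fracInt α k h x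
      = ((1 / chi n k' α : ℝ) : ℂ) * fracInt α k' h x := by
    have h1 : (chi n k α : ℂ) ≠ 0 := Complex.ofReal_ne_zero.2 (hchi k hke hk)
    have h2 : (chi n k' α : ℂ) ≠ 0 := Complex.ofReal_ne_zero.2 (hchi k' hke' hk')
    have := chi_mul_fracInt ha hα hk hk'
    push_cast
    field_simp
    linear_combination this
  rw [e]
  exact (tendsto_setIntegral_compl_ball (ha.integrable_fracIntegrand hα hk')).const_mul _

end

/-! ### Mellin transforms of exponential sums -/

section ExpSum

variable {ι : Type*} (J : Finset ι)

/-- The exponential sum `∑ w_j e^{-a_j t}`. -/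
noncomputable def expSum (w a : ι → ℝ) (t : ℝ) : ℝ := ∑ j ∈ J, w j * Real.exp (-(a j * t))

variable {J} {w a : ι → ℝ}

theorem continuous_expSum : Continuous (expSum J w a) := by
  unfold expSum
  fun_prop

theorem hasDerivAt_expSum (t : ℝ) :
    HasDerivAt (expSum J w a) (-expSum J (fun j => w j * a j) a t) t := by
  unfold expSum
  rw [← Finset.sum_neg_distrib]
  refine HasDerivAt.fun_sum fun j _ => ?_
  have := ((hasDerivAt_id' t).const_mul (a j)).fun_neg.exp.const_mul (w j)
  refine this.congr_deriv ?_
  ring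

theorem abs_expSum_le (ha : ∀ j ∈ J, 0 ≤ a j) {t : ℝ} (ht : 0 ≤ t) :
    |expSum J w a t| ≤ ∑ j ∈ J, |w j| := by
  refine (Finset.abs_sum_le_sum_abs _ _).trans (Finset.sum_le_sum fun j hj => ?_)
  rw [abs_mul, Real.abs_exp]
  refine mul_le_of_le_one_right (abs_nonneg _) (Real.exp_le_one_iff.2 ?_)
  have := mul_nonneg (ha j hj) ht
  linarith

theorem exists_abs_expSum_le_pow (ha : ∀ j ∈ J, 0 ≤ a j) {m : ℕ} (hm : 0 < m)
    (hmom : ∀ i < m, ∑ j ∈ J, w j * a j ^ i = 0) :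
    ∃ C δ : ℝ, 0 ≤ C ∧ 0 < δ ∧ ∀ t : ℝ, 0 < t → t < δ → |expSum J w a t| ≤ C * t ^ m := by
  -- `A` is positive and bounds every `a j`, so `t < 1/A` keeps the exponents in the range of
  -- `Real.exp_bound`.
  set A := ∑ j ∈ J, a j + 1 with hA
  have hA0 : 0 < A := by
    have := Finset.sum_nonneg ha
    linarith
  have haA : ∀ j ∈ J, a j ≤ A := fun j hj => by
    have := Finset.single_le_sum ha hj
    linarith
  refine ⟨∑ j ∈ J, |w j| * (A ^ m * (m.succ / (m.factorial * m))), 1 / A,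
    by positivity, by positivity, fun t ht htδ => ?_⟩
  have htA : A * t ≤ 1 := by
    rw [lt_div_iff₀ hA0] at htδ
    linarith
  have hz : ∑ j ∈ J, w j * ∑ i ∈ Finset.range m, (-(a j * t)) ^ i / i.factorial = 0 := by
    simp only [Finset.mul_sum]
    rw [Finset.sum_comm]
    refine Finset.sum_eq_zero fun i hi => ?_
    rw [← mul_zero ((-t) ^ i / (i.factorial : ℝ)), ← hmom i (Finset.mem_range.1 hi),
      Finset.mul_sum]
    refine Finset.sum_congr rfl fun j _ => ?_
    rw [show -(a j * t) = a j * -t by ring, mul_pow]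
    ring
  rw [expSum, ← sub_zero (∑ j ∈ J, _), ← hz, ← Finset.sum_sub_distrib, Finset.sum_mul]
  refine (Finset.abs_sum_le_sum_abs _ _).trans (Finset.sum_le_sum fun j hj => ?_)
  have h0 : 0 ≤ a j * t := mul_nonneg (ha j hj) ht.le
  have h1 : a j * t ≤ A * t := mul_le_mul_of_nonneg_right (haA j hj) ht.le
  have habs : |-(a j * t)| = a j * t := by rw [abs_neg, abs_of_nonneg h0]
  have hb := Real.exp_bound (x := -(a j * t)) (by rw [habs]; linarith) hm
  rw [habs] at hb
  rw [← mul_sub, abs_mul, mul_assoc]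
  refine mul_le_mul_of_nonneg_left (hb.trans ?_) (abs_nonneg _)
  calc (a j * t) ^ m * (m.succ / (m.factorial * m))
      ≤ (A * t) ^ m * (m.succ / (m.factorial * m)) := by gcongr
    _ = _ := by rw [mul_pow]; ring

/-- Vanishing moments give `O(t^{m-s-1})` at zero; at infinity boundedness of the sum and `s > 0`
suffice. -/
theorem integrableOn_rpow_mul_expSum (ha : ∀ j ∈ J, 0 ≤ a j) {m : ℕ} (hm : 0 < m)
    (hmom : ∀ i < m, ∑ j ∈ J, w j * a j ^ i = 0) {s : ℝ} (hs : 0 < s) (hsm : s < m) :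
    IntegrableOn (fun t => expSum J w a t * t ^ (-s - 1)) (Set.Ioi 0) := by
  obtain ⟨C, δ, hC, hδ, hb⟩ := exists_abs_expSum_le_pow ha hm hmom
  have hmeas : Measurable fun t => expSum J w a t * t ^ (-s - 1) :=
    continuous_expSum.measurable.mul (by fun_prop)
  rw [← Set.Ioo_union_Ici_eq_Ioi hδ]
  refine IntegrableOn.union ?_ ?_
  · have h1 : IntegrableOn (fun t : ℝ => C * t ^ ((m : ℝ) + (-s - 1))) (Set.Ioo 0 δ) :=
      ((intervalIntegral.integrableOn_Ioo_rpow_iff hδ).2 (by linarith)).const_mul C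
    refine h1.mono' hmeas.aestronglyMeasurable ?_
    refine ae_restrict_of_forall_mem measurableSet_Ioo fun t ht => ?_
    have ht0 : 0 < t := ht.1
    rw [norm_mul, Real.norm_eq_abs, Real.norm_of_nonneg (by positivity), Real.rpow_add ht.1,
      Real.rpow_natCast, ← mul_assoc]
    gcongr
    exact hb t ht.1 ht.2
  · have h1 : IntegrableOn (fun t : ℝ => (∑ j ∈ J, |w j|) * t ^ (-s - 1)) (Set.Ioi (δ / 2)) :=
      ((integrableOn_Ioi_rpow_iff (by positivity)).2 (by linarith)).const_mul _
    refine (h1.mono_set fun t (ht : δ ≤ t) => ?_).mono' hmeas.aestronglyMeasurable ?_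
    · exact Set.mem_Ioi.2 (by linarith)
    · refine ae_restrict_of_forall_mem measurableSet_Ici fun t ht => ?_
      have ht0 : 0 < t := hδ.trans_le ht
      rw [norm_mul, Real.norm_eq_abs, Real.norm_of_nonneg (by positivity)]
      gcongr
      exact abs_expSum_le ha ht0.le

/-- Mellin transform of an exponential sum with vanishing moments. -/
theorem integral_rpow_mul_expSum {m : ℕ} : ∀ {w : ι → ℝ} {s : ℝ}, (∀ j ∈ J, 0 ≤ a j) →
    (∀ i < m, ∑ j ∈ J, w j * a j ^ i = 0) → s < m → (∀ i : ℕ, s ≠ i) →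
    (s < 0 → ∀ j ∈ J, a j = 0 → w j = 0) →
    IntegrableOn (fun t => expSum J w a t * t ^ (-s - 1)) (Set.Ioi 0) ∧
    ∫ t in Set.Ioi (0 : ℝ), expSum J w a t * t ^ (-s - 1)
      = Real.Gamma (-s) * ∑ j ∈ J, w j * a j ^ s := by
  -- For `s < 0` each term is a Gamma integral by itself, provided no constant term is present.
  have hneg : ∀ {w : ι → ℝ} {s : ℝ}, (∀ j ∈ J, 0 ≤ a j) → s < 0 →
      (∀ j ∈ J, a j = 0 → w j = 0) →
      IntegrableOn (fun t => expSum J w a t * t ^ (-s - 1)) (Set.Ioi 0) ∧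
      ∫ t in Set.Ioi (0 : ℝ), expSum J w a t * t ^ (-s - 1)
        = Real.Gamma (-s) * ∑ j ∈ J, w j * a j ^ s := by
    intro w s ha hs hw
    have hterm : ∀ j ∈ J, IntegrableOn (fun t => w j * Real.exp (-(a j * t)) * t ^ (-s - 1))
        (Set.Ioi 0) ∧ ∫ t in Set.Ioi (0 : ℝ), w j * Real.exp (-(a j * t)) * t ^ (-s - 1)
          = Real.Gamma (-s) * (w j * a j ^ s) := by
      intro j hj
      by_cases h0 : a j = 0
      · simp [hw j hj h0]
      have hpos : 0 < a j := lt_of_le_of_ne (ha j hj) (Ne.symm h0)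
      have e : ∀ t : ℝ, w j * Real.exp (-(a j * t)) * t ^ (-s - 1)
          = w j * (t ^ (-s - 1) * Real.exp (-(a j * t))) := fun t => by ring
      simp only [e]
      constructor
      · refine Integrable.const_mul ?_ _
        have := integrableOn_rpow_mul_exp (a := -s) (b := a j) (by linarith) hpos
        refine this.congr_fun (fun t _ => ?_) measurableSet_Ioi
        simp only
        congr 2; ring
      · rw [integral_const_mul, Real.integral_rpow_mul_exp_neg_mul_Ioi (by linarith) hpos,
          one_div, Real.inv_rpow hpos.le, Real.rpow_neg hpos.le, inv_inv]
        ring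
    simp only [expSum, Finset.sum_mul]
    refine ⟨integrable_finsetSum _ fun j hj => (hterm j hj).1, ?_⟩
    rw [integral_finsetSum _ fun j hj => (hterm j hj).1, Finset.mul_sum]
    exact Finset.sum_congr rfl fun j hj => (hterm j hj).2
  induction m with
  | zero =>
    intro w s ha _ hs _ hw
    have hs' : s < 0 := by simpa using hs
    exact hneg ha hs' (hw hs')
  | succ m ih =>
    intro w s ha hmom hsm hsi hw
    rcases lt_or_ge s 0 with hs | hs
    · exact hneg ha hs (hw hs)
    have hs0 : 0 < s := lt_of_le_of_ne hs (by simpa using (hsi 0).symm)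
    have hi := integrableOn_rpow_mul_expSum ha (Nat.succ_pos m) hmom hs0 hsm
    -- Differentiation replaces `w j` by `-w j * a j`: the moments shift by one, `s` becomes `s -
    -- 1`, and the constant terms disappear.
    obtain ⟨hi', he'⟩ := ih (w := fun j => w j * a j) (s := s - 1) ha
      (fun i hi => by
        have := hmom (i + 1) (by omega)
        simpa only [pow_succ', mul_assoc] using this)
      (by push_cast at hsm; linarith)
      (fun i h => hsi (i + 1) (by push_cast; linarith))
      (fun _ j _ h0 => by simp [h0])
    refine ⟨hi, ?_⟩
    rw [show -(s - 1) - 1 = -s by ring] at hi' he'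
    have hparts := integral_Ioi_mul_deriv_eq_deriv_mul (a := (0 : ℝ))
      (u := expSum J w a) (u' := fun t => -expSum J (fun j => w j * a j) a t)
      (v := fun t : ℝ => t ^ (-s) / (-s)) (v' := fun t : ℝ => t ^ (-s - 1)) (a' := 0) (b' := 0)
      (fun t _ => hasDerivAt_expSum t)
      (fun t ht => by
        have := (Real.hasDerivAt_rpow_const (x := t) (p := -s) (Or.inl (ne_of_gt ht))).div_const
          (-s)
        rwa [mul_div_cancel_left₀ _ (neg_ne_zero.2 hs0.ne')] at this)
      hi (by
        refine (hi'.const_mul (1 / s)).congr (ae_of_all _ fun t => ?_)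
        simp only [Pi.mul_apply]
        field_simp) ?_ ?_
    · rw [hparts]
      have e : ∀ t : ℝ, -expSum J (fun j => w j * a j) a t * (t ^ (-s) / -s)
          = 1 / s * (expSum J (fun j => w j * a j) a t * t ^ (-s)) := fun t => by field_simp
      simp only [e]
      rw [integral_const_mul, he', show -(s - 1) = -s + 1 by ring,
        Real.Gamma_add_one (neg_ne_zero.2 hs0.ne')]
      have e2 : ∑ j ∈ J, w j * a j * a j ^ (s - 1) = ∑ j ∈ J, w j * a j ^ s := by
        refine Finset.sum_congr rfl fun j hj => ?_
        by_cases h0 : a j = 0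
        · simp [h0, Real.zero_rpow hs0.ne']
        · rw [Real.rpow_sub_one h0]
          field_simp
      rw [e2]
      field_simp
      ring
    -- The boundary term at zero is `O(t^{m+1-s})`.
    · obtain ⟨C, δ, hC, hδ, hb⟩ := exists_abs_expSum_le_pow ha (Nat.succ_pos m) hmom
      have hlim : Tendsto (fun t : ℝ => C / s * t ^ (((m + 1 : ℕ) : ℝ) - s)) (𝓝[>] 0) (𝓝 0) := by
        have h1 : ContinuousAt (fun t : ℝ => C / s * t ^ (((m + 1 : ℕ) : ℝ) - s)) 0 :=
          continuousAt_const.mul (Real.continuousAt_rpow_const _ _ (Or.inr (by linarith)))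
        have h2 := h1.tendsto
        rw [Real.zero_rpow (by linarith), mul_zero] at h2
        exact h2.mono_left nhdsWithin_le_nhds
      refine squeeze_zero_norm' ?_ hlim
      filter_upwards [self_mem_nhdsWithin, mem_nhdsWithin_of_mem_nhds (Iio_mem_nhds hδ)]
        with t ht htδ
      have ht0 : 0 < t := ht
      simp only [Pi.mul_apply]
      rw [norm_mul, norm_div, norm_neg, Real.norm_of_nonneg hs, Real.norm_eq_abs,
        Real.norm_of_nonneg (by positivity), sub_eq_add_neg, Real.rpow_add ht0, Real.rpow_natCast]
      calc _ ≤ C * t ^ (m + 1) * (t ^ (-s) / s) := by gcongr; exact hb t ht0 htδ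
        _ = _ := by ring
    · have hlim : Tendsto (fun t : ℝ => (∑ j ∈ J, |w j|) / s * t ^ (-s)) atTop (𝓝 0) := by
        simpa using (tendsto_rpow_neg_atTop hs0).const_mul ((∑ j ∈ J, |w j|) / s)
      refine squeeze_zero_norm' ?_ hlim
      filter_upwards [eventually_gt_atTop 0] with t ht
      simp only [Pi.mul_apply]
      rw [norm_mul, norm_div, norm_neg, Real.norm_of_nonneg hs, Real.norm_eq_abs,
        Real.norm_of_nonneg (by positivity)]
      calc _ ≤ (∑ j ∈ J, |w j|) * (t ^ (-s) / s) := by gcongr; exact abs_expSum_le ha ht.le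
        _ = _ := by ring

end ExpSum

/-! ### Nonvanishing of the normalising constant -/

/-- The alternating Gaussian sum `∑_j (-1)^j (k choose j) e^{-(k/2-j)² t}`. -/
noncomputable def gaussDiff (k : ℕ) : ℝ → ℝ :=
  expSum (Finset.range (k + 1)) (fun j => (-1 : ℝ) ^ j * (k.choose j : ℝ))
    (fun j => ((k : ℝ) / 2 - (j : ℝ)) ^ 2)

/-- The binomial expansion of `(e^{iθ} - e^{-iθ})^{2m} = (2i sin θ)^{2m}`. -/
theorem sum_choose_mul_cexp (m : ℕ) (θ : ℂ) :
    ∑ j ∈ Finset.range (2 * m + 1), (-1 : ℂ) ^ j * ((2 * m).choose j : ℂ) *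
      Complex.exp (Complex.I * (2 * ((m : ℂ) - j)) * θ) = (-1) ^ m * (4 * Complex.sin θ ^ 2) ^ m := by
  have h := add_pow (-Complex.exp (-(Complex.I * θ))) (Complex.exp (Complex.I * θ)) (2 * m)
  have hs : -Complex.exp (-(Complex.I * θ)) + Complex.exp (Complex.I * θ)
      = 2 * Complex.I * Complex.sin θ := by
    rw [Complex.sin, mul_comm Complex.I θ, ← neg_mul]
    linear_combination (-Complex.exp (-θ * Complex.I) + Complex.exp (θ * Complex.I)) *
      (Complex.I_sq)
  rw [hs, pow_mul] at h
  rw [← mul_pow, show (-1 : ℂ) * (4 * Complex.sin θ ^ 2) = (2 * Complex.I * Complex.sin θ) ^ 2 by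
    linear_combination -4 * Complex.sin θ ^ 2 * Complex.I_sq, h]
  refine Finset.sum_congr rfl fun j hj => ?_
  have hj' : j ≤ 2 * m := Nat.lt_succ_iff.1 (Finset.mem_range.1 hj)
  have e : Complex.exp (Complex.I * (2 * ((m : ℂ) - j)) * θ)
      = Complex.exp (-(Complex.I * θ)) ^ j * Complex.exp (Complex.I * θ) ^ (2 * m - j) := by
    rw [← Complex.exp_nat_mul, ← Complex.exp_nat_mul, ← Complex.exp_add, Nat.cast_sub hj']
    congr 1
    push_cast
    ring
  rw [e, neg_pow (Complex.exp _)]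
  ring

/-- Writing each Gaussian as a Fourier integral turns the alternating sum into `(-1)^m` times the
integral of `(4 sin²(√t x))^m e^{-x²}`, up to `√π`. -/
theorem gaussDiff_pos (m : ℕ) {t : ℝ} (ht : 0 < t) : 0 < (-1) ^ m * gaussDiff (2 * m) t := by
  set g : ℝ → ℝ := fun x => (4 * Real.sin (Real.sqrt t * x) ^ 2) ^ m * Real.exp (-x ^ 2) with hg
  have hgauss : Integrable fun x : ℝ => Complex.exp (-1 * (x : ℂ) ^ 2) :=
    integrable_cexp_neg_mul_sq (by simp)
  have hexp_i : ∀ τ : ℝ, Integrable fun x : ℝ =>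
      Complex.exp (Complex.I * τ * x) * Complex.exp (-1 * (x : ℂ) ^ 2) := fun τ => by
    refine hgauss.bdd_mul (c := 1) (Measurable.aestronglyMeasurable (by fun_prop))
      (ae_of_all _ fun x => ?_)
    rw [show Complex.I * (τ : ℂ) * x = ((τ * x : ℝ) : ℂ) * Complex.I by push_cast; ring,
      Complex.norm_exp_ofReal_mul_I]
  -- Frequencies chosen so that `e^{-τ_j²/4} = e^{-(m-j)² t}`.
  set τ : ℕ → ℝ := fun j => 2 * ((m : ℝ) - j) * Real.sqrt t with hτ
  have hpt : ∀ x : ℝ, ∑ j ∈ Finset.range (2 * m + 1), (-1 : ℂ) ^ j * ((2 * m).choose j : ℂ) *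
      (Complex.exp (Complex.I * τ j * x) * Complex.exp (-1 * (x : ℂ) ^ 2))
      = (-1) ^ m * (g x : ℂ) := by
    intro x
    have h1 := sum_choose_mul_cexp m ((Real.sqrt t * x : ℝ) : ℂ)
    have h2 : ∀ j : ℕ, Complex.exp (Complex.I * τ j * x)
        = Complex.exp (Complex.I * (2 * ((m : ℂ) - j)) * ((Real.sqrt t * x : ℝ) : ℂ)) := fun j => by
      simp only [hτ]; push_cast; congr 1; ring
    simp only [h2]
    simp only [← mul_assoc ((-1 : ℂ) ^ _ * _) (Complex.exp _)]
    rw [← Finset.sum_mul, h1, hg]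
    push_cast
    rw [neg_one_mul]
    ring
  have hgi : Integrable g := by
    have h1 : Integrable fun x : ℝ => (-1) ^ m * (g x : ℂ) := by
      simp only [← hpt]
      exact integrable_finsetSum _ fun j _ => (hexp_i _).const_mul _
    have h2 := (h1.const_mul ((-1) ^ m)).re
    refine h2.congr (ae_of_all _ fun x => ?_)
    have : ((-1 : ℂ) ^ m * ((-1) ^ m * (g x : ℂ))) = (g x : ℂ) := by
      rw [← mul_assoc, ← pow_add, ← two_mul, pow_mul]; simp
    simp only [this]
    rfl
  have hint : (-1 : ℂ) ^ m * ((∫ x, g x : ℝ) : ℂ)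
      = ((Real.sqrt Real.pi : ℝ) : ℂ) * ((gaussDiff (2 * m) t : ℝ) : ℂ) := by
    rw [← integral_complex_ofReal, ← integral_const_mul]
    simp only [← hpt]
    rw [integral_finsetSum _ fun j _ => (hexp_i _).const_mul _]
    simp only [integral_const_mul]
    rw [gaussDiff, expSum]
    push_cast
    rw [Finset.mul_sum]
    refine Finset.sum_congr rfl fun j _ => ?_
    rw [fourierIntegral_gaussian (by simp) (τ j : ℂ)]
    have e1 : ((Real.pi : ℂ) / 1) ^ (1 / 2 : ℂ) = ((Real.sqrt Real.pi : ℝ) : ℂ) := by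
      rw [div_one, Real.sqrt_eq_rpow, Complex.ofReal_cpow Real.pi_pos.le]
      simp
    have e2 : -(τ j : ℂ) ^ 2 / (4 * 1) = -((2 * (m : ℂ) / 2 - j) ^ 2 * t) := by
      have : ((Real.sqrt t : ℝ) : ℂ) ^ 2 = t := by
        rw [← Complex.ofReal_pow, Real.sq_sqrt ht.le]
      simp only [hτ]
      push_cast
      linear_combination -((m : ℂ) - j) ^ 2 * this
    rw [e1, e2]
    ring
  have hpos : 0 < ∫ x, g x := by
    have hc : Continuous g := by fun_prop
    rw [integral_pos_iff_support_of_nonneg (fun x => by positivity) hgi]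
    have hst : Real.sqrt t ≠ 0 := (Real.sqrt_pos.2 ht).ne'
    -- At this point the sine equals 1, so the integrand is nonzero there.
    refine (isOpen_ne_fun hc continuous_const).measure_pos volume
      ⟨Real.pi / 2 / Real.sqrt t, ?_⟩
    simp only [Set.mem_ofPred_eq, hg]
    rw [mul_div_cancel₀ _ hst, Real.sin_pi_div_two]
    positivity
  have hreal : (-1 : ℝ) ^ m * (∫ x, g x) = Real.sqrt Real.pi * gaussDiff (2 * m) t := by
    exact_mod_cast hint
  have hsp : 0 < Real.sqrt Real.pi := Real.sqrt_pos.2 Real.pi_pos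
  have e : (-1) ^ m * gaussDiff (2 * m) t = (∫ x, g x) / Real.sqrt Real.pi := by
    rw [eq_div_iff hsp.ne', mul_assoc, mul_comm (gaussDiff _ _), ← hreal, ← mul_assoc, ← pow_add,
      ← two_mul, pow_mul]
    simp
  rw [e]
  positivity

/-- With `a_j = (m - j)²` the moments of order `i < m` are centered moments of order `2i < 2m`,
hence zero. -/
theorem Gamma_mul_chiSum {m : ℕ} {β : ℝ} (h0 : 0 < β) (hβ : β < 2 * m)
    (hne : ∀ i : ℕ, β / 2 ≠ i) :
    IntegrableOn (fun t => gaussDiff (2 * m) t * t ^ (-(β / 2) - 1)) (Set.Ioi 0) ∧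
    ∫ t in Set.Ioi (0 : ℝ), gaussDiff (2 * m) t * t ^ (-(β / 2) - 1)
      = Real.Gamma (-β / 2) * chiSum (2 * m) β := by
  have h := integral_rpow_mul_expSum (J := Finset.range (2 * m + 1))
    (a := fun j : ℕ => (((2 * m : ℕ) : ℝ) / 2 - (j : ℝ)) ^ 2)
    (w := fun j => (-1 : ℝ) ^ j * ((2 * m).choose j : ℝ)) (s := β / 2) (m := m)
    (fun j _ => by positivity)
    (fun i hi => by
      simp only [← pow_mul]
      exact centeredMoment_eq_zero (by omega))
    (by linarith) hne (fun h => by linarith)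
  refine ⟨h.1, h.2.trans ?_⟩
  rw [neg_div, chiSum]
  congr 1
  refine Finset.sum_congr rfl fun j _ => ?_
  have e : (|((2 * m : ℕ) : ℝ) / 2 - (j : ℝ)| ^ 2) ^ (β / 2)
      = |((2 * m : ℕ) : ℝ) / 2 - (j : ℝ)| ^ β := by
    rw [← Real.rpow_natCast |((2 * m : ℕ) : ℝ) / 2 - (j : ℝ)| 2, ← Real.rpow_mul (abs_nonneg _)]
    congr 1
    push_cast
    ring
  rw [← sq_abs, e]

/-- On `[1,2]` the power `t^{-β/2-1}` is at least `t^{-m-1}`. The bound is uniform in `β` and so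
survives the limit at even integers. -/
theorem exists_le_Gamma_mul_chiSum (m : ℕ) : ∃ κ : ℝ, 0 < κ ∧ ∀ β : ℝ, 0 < β → β < 2 * m →
    (∀ i : ℕ, β / 2 ≠ i) → κ ≤ (-1) ^ m * (Real.Gamma (-β / 2) * chiSum (2 * m) β) := by
  have hc : Continuous (gaussDiff (2 * m)) := continuous_expSum
  refine ⟨∫ t in (1 : ℝ)..2, (-1) ^ m * gaussDiff (2 * m) t * t ^ (-(m : ℝ) - 1), ?_, ?_⟩
  · refine intervalIntegral.intervalIntegral_pos_of_pos_on ?_ (fun t ht => ?_) (by norm_num)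
    · refine ContinuousOn.intervalIntegrable ?_
      rw [Set.uIcc_of_le (by norm_num)]
      exact (continuous_const.mul hc).continuousOn.mul (ContinuousOn.rpow_const continuousOn_id
        fun t ht => Or.inl (ne_of_gt (lt_of_lt_of_le one_pos ht.1)))
    · have ht0 : 0 < t := by linarith [ht.1]
      have := gaussDiff_pos m ht0
      positivity
  · intro β h0 hβ hne
    obtain ⟨hi, he⟩ := Gamma_mul_chiSum h0 hβ hne
    rw [← he, ← integral_const_mul, intervalIntegral.integral_of_le (by norm_num)]
    have hpos : ∀ t ∈ Set.Ioi (0 : ℝ), 0 ≤ (-1) ^ m * (gaussDiff (2 * m) t *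
        t ^ (-(β / 2) - 1)) := fun t ht => by
      have ht0 : 0 < t := ht
      have := gaussDiff_pos m ht0
      rw [← mul_assoc]
      positivity
    have hi' : IntegrableOn (fun t => (-1) ^ m * (gaussDiff (2 * m) t * t ^ (-(β / 2) - 1)))
        (Set.Ioi 0) := hi.const_mul ((-1 : ℝ) ^ m)
    have hsub : Set.Ioc (1 : ℝ) 2 ⊆ Set.Ioi 0 := fun t ht => lt_trans one_pos ht.1
    refine le_trans ?_ (setIntegral_mono_set hi' (ae_restrict_of_forall_mem measurableSet_Ioi hpos)
      (LE.le.eventuallyLE hsub))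
    refine setIntegral_mono_on ?_ (hi'.mono_set hsub) measurableSet_Ioc fun t ht => ?_
    · refine ContinuousOn.integrableOn_compact isCompact_Icc ?_ |>.mono_set Set.Ioc_subset_Icc_self
      exact (continuous_const.mul hc).continuousOn.mul (ContinuousOn.rpow_const continuousOn_id
        fun t ht => Or.inl (ne_of_gt (lt_of_lt_of_le one_pos ht.1)))
    · have := gaussDiff_pos m (hsub ht)
      rw [← mul_assoc]
      gcongr
      · exact ht.1.le
      · linarith

theorem chi_ne_zero {n k : ℕ} (hke : Even k) {α : ℝ} (hα : 0 < α) (hk : α < k) :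
    chi n k α ≠ 0 := by
  obtain ⟨m, rfl⟩ := hke.two_dvd
  obtain ⟨κ, hκ, hle⟩ := exists_le_Gamma_mul_chiSum m
  set A : ℝ → ℝ := fun β => 2 ^ (-β) * Real.pi ^ ((n : ℝ) / 2) /
    Real.Gamma (((n : ℝ) - -β) / 2) with hA
  have hpos : 0 < ((n : ℝ) - -α) / 2 := by
    have := n.cast_nonneg (α := ℝ)
    linarith
  have hA0 : 0 < A α := by
    have := Real.Gamma_pos_of_pos hpos
    simp only [hA]
    positivity
  have hAc : ContinuousAt A α := by
    have hG : ContinuousAt (fun β : ℝ => Real.Gamma (((n : ℝ) - -β) / 2)) α :=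
      ContinuousAt.comp (g := Real.Gamma) (f := fun β : ℝ => ((n : ℝ) - -β) / 2)
        (Real.differentiableAt_Gamma (fun i => by
          have := i.cast_nonneg (α := ℝ)
          intro h
          linarith)).continuousAt (by fun_prop)
    have h2 : ContinuousAt (fun β : ℝ => (2 : ℝ) ^ (-β)) α :=
      ContinuousAt.rpow continuousAt_const (by fun_prop) (Or.inl two_ne_zero)
    exact (h2.mul continuousAt_const).div hG (Real.Gamma_pos_of_pos hpos).ne'
  have hle' : 𝓝[>] α ≤ 𝓝[≠] α := nhdsWithin_mono _ fun β hβ => ne_of_gt hβ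
  have ht : Tendsto (fun β => (-1) ^ m * -chiFormula n (2 * m) β) (𝓝[>] α)
      (𝓝 ((-1) ^ m * -chi n (2 * m) α)) :=
    (((tendsto_chiFormula n (2 * m) hα hk).mono_left hle').neg).const_mul _
  have htA : Tendsto (fun β => A β * κ) (𝓝[>] α) (𝓝 (A α * κ)) :=
    (hAc.tendsto.mono_left nhdsWithin_le_nhds).mul_const κ
  have hge : A α * κ ≤ (-1) ^ m * -chi n (2 * m) α := by
    refine le_of_tendsto_of_tendsto htA ht ?_
    -- No even integer lies strictly between `α` and this bound, so `β/2` avoids the poles of Gamma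
    -- for `β` slightly above `α`.
    have hfl : α < 2 * ((⌊α / 2⌋₊ : ℝ) + 1) := by
      have := Nat.lt_floor_add_one (α / 2)
      linarith
    have hAev : ∀ᶠ β in 𝓝[>] α, 0 < A β :=
      (hAc.tendsto.mono_left nhdsWithin_le_nhds).eventually_const_lt hA0
    filter_upwards [self_mem_nhdsWithin, mem_nhdsWithin_of_mem_nhds (Iio_mem_nhds hk),
      mem_nhdsWithin_of_mem_nhds (Iio_mem_nhds hfl), hAev] with β h1 h2 h3 h4
    have h1' : α < β := h1
    have h2' : β < 2 * m := by simpa using h2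
    have h3' : β < 2 * ((⌊α / 2⌋₊ : ℝ) + 1) := h3
    have hb := hle β (hα.trans h1') h2' (fun i hi => by
      have h5 : (i : ℝ) < (⌊α / 2⌋₊ : ℝ) + 1 := by linarith
      have h6 : i ≤ ⌊α / 2⌋₊ := by
        have : i < ⌊α / 2⌋₊ + 1 := by exact_mod_cast h5
        omega
      have h7 := (Nat.le_floor_iff (by positivity)).1 h6
      linarith)
    have e : (-1) ^ m * -chiFormula n (2 * m) β
        = A β * ((-1) ^ m * (Real.Gamma (-β / 2) * chiSum (2 * m) β)) := by
      simp only [chiFormula, rieszGamma, hA, chiSum]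
      ring
    rw [e]
    gcongr
  intro h
  rw [h, neg_zero, mul_zero] at hge
  have := mul_pos hA0 hκ
  linarith

/-! ### The fractional Laplacian of a solid harmonic times a radial function -/

theorem integral_comp_affine_mul_gaussian {n : ℕ} (h : Euc n → ℂ) (x : Euc n) {c : ℝ} (hc : c ≠ 0)
    (t : ℝ) :
    ∫ y : Euc n, h (x + c • y) * (Real.exp (-t * ‖y‖ ^ 2) : ℂ)
      = (((|c| ^ n)⁻¹ : ℝ) : ℂ) *
        ∫ y : Euc n, h y * (Real.exp (-(t / c ^ 2) * ‖x - y‖ ^ 2) : ℂ) := by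
  have h1 := Measure.integral_comp_smul (volume : Measure (Euc n))
    (fun z => h (x + z) * (Real.exp (-(t / c ^ 2) * ‖z‖ ^ 2) : ℂ)) c
  have h2 := integral_add_left_eq_self (μ := (volume : Measure (Euc n)))
    (fun z => h z * (Real.exp (-(t / c ^ 2) * ‖x - z‖ ^ 2) : ℂ)) x
  simp only [sub_add_cancel_left, norm_neg] at h2
  rw [h2, finrank_euclideanSpace_fin, abs_inv, abs_pow, Complex.real_smul] at h1
  rw [← h1]
  refine integral_congr_ae (ae_of_all _ fun y => ?_)
  simp only [norm_smul, Real.norm_eq_abs, mul_pow, sq_abs]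
  congr 3
  field_simp

theorem fracAdmissible_solidHarmonic_mul {d : ℕ} {x : Euc d} {α : ℝ}
    (V : MvPolynomial (Fin d) ℂ) {f : Euc d → ℂ}
    (hf : ContDiffAt ℝ ∞ f x)
    (hi : Integrable fun y : Euc d => polyFun V y * f y * (((1 + ‖y‖) ^ (-(α + d)) : ℝ) : ℂ)) :
    FracAdmissible α (fun y => polyFun V y * f y) x :=
  ⟨hi, fun _ hk => exists_centeredDiff_le hk
    (((contDiff_polyFun V).contDiffAt.mul hf).of_le (by exact_mod_cast le_top))⟩

section

variable {d l : ℕ} [Nontrivial (Euc d)] [Nontrivial (Euc (d + 2 * l))]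
  {V : MvPolynomial (Fin d) ℂ} {φ : ℝ → ℂ} {x : Euc d} {x' : Euc (d + 2 * l)} {α : ℝ}

theorem integrable_lift_fracWeight (hl : V.IsHomogeneous l) (hV0 : V ≠ 0)
    (hi : Integrable fun y : Euc d =>
      polyFun V y * φ ‖y‖ * (((1 + ‖y‖) ^ (-(α + d)) : ℝ) : ℂ)) :
    Integrable fun y : Euc (d + 2 * l) =>
      φ ‖y‖ * (((1 + ‖y‖) ^ (-(α + (d + 2 * l : ℕ))) : ℝ) : ℂ) := by
  refine integrable_bdd_mul_weight (C := 1) (integrable_lift_weight hl hV0 hi)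
    (ae_of_all _ (weight_pos _)) (measurable_weight _) (measurable_weight _)
    (ae_of_all _ fun y => ?_)
  rw [abs_of_pos (weight_pos _ _), one_mul]
  refine Real.rpow_le_rpow_of_exponent_le (by linarith [norm_nonneg y]) ?_
  have := l.cast_nonneg (α := ℝ)
  push_cast
  linarith

/-- Dilation by `c` changes `t` to `t/c²`; since `(t/c²)^l |c|^{-d} = t^l |c|^{-(d+2l)}`, the
constant is the same for all `c`, and the identity can be summed over the nodes of a centered
difference. -/
theorem integral_comp_affine_solidHarmonic (hV : IsSolidHarmonic V l)
    (hi : Integrable fun y : Euc d =>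
      polyFun V y * φ ‖y‖ * (((1 + ‖y‖) ^ (-(α + d)) : ℝ) : ℂ))
    (hx : ‖x'‖ = ‖x‖) {t : ℝ} (ht : 0 < t) (c : ℝ) :
    ∫ y : Euc d, polyFun V (x + c • y) * φ ‖x + c • y‖ * (Real.exp (-t * ‖y‖ ^ 2) : ℂ)
      = (((t / Real.pi) ^ l : ℝ) : ℂ) * polyFun V x *
        ∫ y : Euc (d + 2 * l), φ ‖x' + c • y‖ * (Real.exp (-t * ‖y‖ ^ 2) : ℂ) := by
  -- The middle node of an even-order difference, where only the total Gaussian masses in the two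
  -- dimensions are compared.
  by_cases hc : c = 0
  · simp only [hc, zero_smul, add_zero]
    rw [integral_const_mul, integral_const_mul, integral_gaussian ht, integral_gaussian ht, hx]
    have e : (Real.pi / t) ^ ((d : ℝ) / 2)
        = (t / Real.pi) ^ l * (Real.pi / t) ^ (((d + 2 * l : ℕ) : ℝ) / 2) := by
      rw [show ((d + 2 * l : ℕ) : ℝ) / 2 = (d : ℝ) / 2 + (l : ℝ) by push_cast; ring,
        Real.rpow_add (by positivity), Real.rpow_natCast, div_pow, div_pow]
      have := Real.pi_pos
      field_simp
    rw [e]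
    push_cast
    ring
  · have h1 := integral_comp_affine_mul_gaussian (fun y => polyFun V y * φ ‖y‖) x hc t
    have h2 := integral_comp_affine_mul_gaussian (fun y : Euc (d + 2 * l) => φ ‖y‖) x' hc t
    have hcp : 0 < |c| := abs_pos.2 hc
    rw [h1, h2, integral_solidHarmonic_radial_mul_gaussian hV hi hx (t := t / c ^ 2)
      (by positivity)]
    have e : (|c| ^ d)⁻¹ * (t / c ^ 2 / Real.pi) ^ l
        = (t / Real.pi) ^ l * (|c| ^ (d + 2 * l))⁻¹ := by
      rw [pow_add, pow_mul, sq_abs, div_div, div_pow, div_pow, mul_pow]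
      have := Real.pi_pos
      field_simp
    have e' := congrArg (fun r : ℝ => (r : ℂ)) e
    simp only [Complex.ofReal_mul] at e'
    linear_combination (polyFun V x *
      ∫ y : Euc (d + 2 * l), φ ‖y‖ * (Real.exp (-(t / c ^ 2) * ‖x' - y‖ ^ 2) : ℂ)) * e'

theorem integral_centeredDiff_mul_gaussian {n : ℕ} {h : Euc n → ℂ} (hα : 0 < α)
    (hi : Integrable fun y => h y * (((1 + ‖y‖) ^ (-(α + n)) : ℝ) : ℂ)) (x : Euc n) (k : ℕ)
    {t : ℝ} (ht : 0 < t) :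
    ∫ y, centeredDiff k h x y * (Real.exp (-t * ‖y‖ ^ 2) : ℂ)
      = ∑ j ∈ Finset.range (k + 1), (-1 : ℂ) ^ j * (k.choose j : ℂ) *
        ∫ y, h (x + ((k : ℝ) / 2 - (j : ℝ)) • y) * (Real.exp (-t * ‖y‖ ^ 2) : ℂ) := by
  have hint : ∀ c : ℝ, Integrable fun y =>
      h (x + c • y) * (Real.exp (-t * ‖y‖ ^ 2) : ℂ) := fun c => by
    simpa using integrable_mul_gaussian (integrable_comp_affine_mul_weight hα hi x c) ht 0
  simp only [centeredDiff, Finset.sum_mul, mul_assoc]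
  rw [integral_finsetSum _ fun j _ => ((hint _).const_mul _).const_mul _]
  simp only [integral_const_mul]

theorem Gamma_mul_fracInt {n : ℕ} [Nontrivial (Euc n)] {h : Euc n → ℂ} {x : Euc n}
    (ha : FracAdmissible α h x) (hα : 0 < α) {k : ℕ} (hk : α < k) :
    (Real.Gamma ((α + n) / 2) : ℂ) * fracInt α k h x
      = -∫ t in Set.Ioi (0 : ℝ), ((t ^ ((α + n) / 2 - 1) : ℝ) : ℂ) *
        ∫ y, centeredDiff k h x y * (Real.exp (-t * ‖y‖ ^ 2) : ℂ) := by
  have hpos : ∀ᵐ y : Euc n, 0 < ‖y‖ := by simpa using ae_norm_sub_pos (0 : Euc n)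
  have hi : Integrable fun y => centeredDiff k h x y * ((‖y‖ ^ (-(α + n)) : ℝ) : ℂ) := by
    refine (ha.integrable_fracIntegrand hα hk).neg.congr (ae_of_all _ fun y => ?_)
    simp only [Pi.neg_apply, fracIntegrand_eq, neg_neg]
  rw [← integral_mellin (aestronglyMeasurable_of_mul_weight
    (integrable_centeredDiff_mul_weight hα ha.integrable_weight x k)) (u := fun y => ‖y‖)
    (by fun_prop) hpos (by positivity) hi, fracInt, ← mul_neg, ← integral_neg]
  simp only [fracIntegrand_eq]

theorem Gamma_mul_fracInt_solidHarmonic (hV : IsSolidHarmonic V l) (hα : 0 < α)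
    (ha : FracAdmissible α (fun y => polyFun V y * φ ‖y‖) x)
    (ha' : FracAdmissible α (fun y : Euc (d + 2 * l) => φ ‖y‖) x')
    (hx : ‖x'‖ = ‖x‖) {k : ℕ} (hk : α < k) :
    (Real.Gamma ((α + d) / 2) : ℂ) * fracInt α k (fun y => polyFun V y * φ ‖y‖) x
      = (((Real.pi ^ l)⁻¹ : ℝ) : ℂ) * polyFun V x * ((Real.Gamma ((α + (d + 2 * l : ℕ)) / 2) : ℂ) *
        fracInt α k (fun y : Euc (d + 2 * l) => φ ‖y‖) x') := by
  rw [Gamma_mul_fracInt ha hα hk, Gamma_mul_fracInt ha' hα hk, mul_neg, ← integral_const_mul]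
  refine congrArg Neg.neg (setIntegral_congr_fun measurableSet_Ioi fun t ht => ?_)
  have ht' : 0 < t := ht
  rw [integral_centeredDiff_mul_gaussian hα ha.integrable_weight x k ht',
    integral_centeredDiff_mul_gaussian hα ha'.integrable_weight x' k ht']
  simp only [integral_comp_affine_solidHarmonic hV ha.integrable_weight hx ht']
  have e2 : t ^ ((α + (d + 2 * l : ℕ)) / 2 - 1) = t ^ ((α + d) / 2 - 1) * t ^ l := by
    rw [← Real.rpow_natCast t l, ← Real.rpow_add ht']
    congr 1; push_cast; ring
  rw [e2, div_pow, Finset.mul_sum, Finset.mul_sum, Finset.mul_sum]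
  refine Finset.sum_congr rfl fun j _ => ?_
  push_cast
  ring

/-- Away from even integers `Γ((α+n)/2) χ_{n,k}(α)` depends on `n` only through `π^{n/2}`; the
identity extends to even integers by continuity. -/
theorem chi_dimension_shift (d l : ℕ) {k : ℕ} (hα : 0 < α) (hk : α < k) :
    Real.Gamma ((α + d) / 2) * Real.pi ^ l * chi d k α
      = Real.Gamma ((α + (d + 2 * l : ℕ)) / 2) * chi (d + 2 * l) k α := by
  have hG : ∀ n : ℕ, Tendsto (fun β : ℝ => Real.Gamma ((β + n) / 2)) (𝓝[≠] α)
      (𝓝 (Real.Gamma ((α + n) / 2))) := fun n => by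
    have hn := n.cast_nonneg (α := ℝ)
    have : ContinuousAt (fun β : ℝ => Real.Gamma ((β + n) / 2)) α :=
      ContinuousAt.comp (g := Real.Gamma) (f := fun β : ℝ => (β + n) / 2)
        (Real.differentiableAt_Gamma (fun i => by
          have := i.cast_nonneg (α := ℝ)
          intro h
          linarith)).continuousAt (by fun_prop)
    exact this.tendsto.mono_left nhdsWithin_le_nhds
  refine tendsto_nhds_unique (((hG d).mul_const _).mul (tendsto_chiFormula d k hα hk))
    (((hG (d + 2 * l)).mul (tendsto_chiFormula (d + 2 * l) k hα hk)).congr' ?_)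
  have hpos : ∀ᶠ β in 𝓝[≠] α, 0 < β := mem_nhdsWithin_of_mem_nhds (Ioi_mem_nhds hα)
  filter_upwards [hpos] with β hβ
  have g1 : ∀ n : ℕ, Real.Gamma ((β + n) / 2) ≠ 0 := fun n =>
    (Real.Gamma_pos_of_pos (by positivity)).ne'
  have e1 : ∀ n : ℕ, Real.Gamma ((β + n) / 2) * chiFormula n k β
      = -(2 ^ (-β) * Real.pi ^ ((n : ℝ) / 2) * Real.Gamma (-β / 2)) * chiSum k β := fun n => by
    have : ((n : ℝ) - -β) / 2 = (β + n) / 2 := by ring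
    rw [chiFormula, rieszGamma, chiSum, this]
    field_simp [g1 n]
  have e2 : Real.pi ^ (((d + 2 * l : ℕ) : ℝ) / 2) = Real.pi ^ ((d : ℝ) / 2) * Real.pi ^ l := by
    rw [← Real.rpow_natCast Real.pi l, ← Real.rpow_add Real.pi_pos]
    congr 1; push_cast; ring
  rw [e1, e2]
  linear_combination -(Real.pi ^ l) * e1 d

/-- Off the origin the lift is `f` composed with `y ↦ |y| x/|x|`, hence smooth. At the origin the
norm is not smooth, but the centered difference of a radial function depends only on `|y|` and is
read off from `f` along a unit vector. This is why admissibility asks for bounds on differences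
instead of smoothness. -/
theorem fracAdmissible_lift (hl : V.IsHomogeneous l) (hV0 : V ≠ 0)
    (hf : ContDiffAt ℝ ∞ (fun y : Euc d => φ ‖y‖) x)
    (hi : Integrable fun y : Euc d =>
      polyFun V y * φ ‖y‖ * (((1 + ‖y‖) ^ (-(α + d)) : ℝ) : ℂ))
    (hx : ‖x'‖ = ‖x‖) :
    FracAdmissible α (fun y : Euc (d + 2 * l) => φ ‖y‖) x' := by
  refine ⟨integrable_lift_fracWeight hl hV0 hi, fun k hk => ?_⟩
  have hfk : ContDiffAt ℝ k (fun y : Euc d => φ ‖y‖) x := hf.of_le (by exact_mod_cast le_top)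
  by_cases h0 : x = 0
  · obtain ⟨e, he⟩ := exists_norm_eq (Euc d) zero_le_one
    have h0' : x' = 0 := by simpa [h0] using hx
    obtain ⟨C, δ, hC, hδ, hb⟩ := exists_centeredDiff_le hk hfk
    refine ⟨C, δ, hC, hδ, fun y hy => ?_⟩
    have h1 : centeredDiff k (fun y : Euc (d + 2 * l) => φ ‖y‖) x' y
        = centeredDiff k (fun y : Euc d => φ ‖y‖) x (‖y‖ • e) := by
      simp [centeredDiff, h0, h0', norm_smul, he]
    have h2 : ‖‖y‖ • e‖ = ‖y‖ := by simp [norm_smul, he]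
    rw [h1]
    simpa [h2] using hb (‖y‖ • e) (by rwa [h2])
  · refine exists_centeredDiff_le hk ?_
    have hn : ‖x‖ ≠ 0 := norm_ne_zero_iff.2 h0
    have h0' : x' ≠ 0 := by
      rw [← norm_ne_zero_iff, hx]; exact hn
    have e : (fun y : Euc (d + 2 * l) => φ ‖y‖)
        = (fun y : Euc d => φ ‖y‖) ∘ fun y : Euc (d + 2 * l) => ‖y‖ • (‖x‖⁻¹ • x) := by
      ext y
      simp [norm_smul, hn]
    rw [e]
    refine ContDiffAt.comp x' ?_ ((contDiffAt_norm ℝ h0').smul contDiffAt_const)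
    rwa [hx, smul_smul, mul_inv_cancel₀ hn, one_smul]

theorem hasFracLaplacian_solidHarmonic_radial (hV : IsSolidHarmonic V l) (hV0 : V ≠ 0)
    (hα : 0 < α) (hf : ContDiffAt ℝ ∞ (fun y : Euc d => φ ‖y‖) x)
    (hi : Integrable fun y : Euc d =>
      polyFun V y * φ ‖y‖ * (((1 + ‖y‖) ^ (-(α + d)) : ℝ) : ℂ))
    (hx : ‖x'‖ = ‖x‖) :
    ∃ L : ℂ, HasFracLaplacian α (fun y => polyFun V y * φ ‖y‖) x (polyFun V x * L) ∧
      HasFracLaplacian α (fun y : Euc (d + 2 * l) => φ ‖y‖) x' L := by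
  have ha := fracAdmissible_solidHarmonic_mul V hf hi
  have ha' := fracAdmissible_lift hV.1 hV0 hf hi hx
  -- Any even order above `α` can be used to name the value.
  have hke : Even (2 * (⌊α⌋₊ + 1)) := even_two_mul _
  have hk : α < ((2 * (⌊α⌋₊ + 1) : ℕ) : ℝ) := by
    have := Nat.lt_floor_add_one α
    push_cast
    linarith
  set k := 2 * (⌊α⌋₊ + 1)
  have h1 := ha.hasFracLaplacian hα (fun _ => fun h h' => chi_ne_zero h hα h') hke hk
  have h2 := ha'.hasFracLaplacian hα (fun _ => fun h h' => chi_ne_zero h hα h') hke hk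
  refine ⟨_, ?_, h2⟩
  convert h1 using 1
  have c1 : (chi d k α : ℂ) ≠ 0 := Complex.ofReal_ne_zero.2 (chi_ne_zero hke hα hk)
  have c2 : (chi (d + 2 * l) k α : ℂ) ≠ 0 := Complex.ofReal_ne_zero.2 (chi_ne_zero hke hα hk)
  have g1 : (Real.Gamma ((α + d) / 2) : ℂ) ≠ 0 :=
    Complex.ofReal_ne_zero.2 (Real.Gamma_pos_of_pos (by positivity)).ne'
  have hpi : (Real.pi : ℂ) ≠ 0 := Complex.ofReal_ne_zero.2 Real.pi_ne_zero
  have e1 := Gamma_mul_fracInt_solidHarmonic hV hα ha ha' hx hk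
  have e2 := congrArg (fun r : ℝ => (r : ℂ)) (chi_dimension_shift d l hα hk)
  simp only [Complex.ofReal_mul, Complex.ofReal_pow] at e2
  rw [Complex.ofReal_inv, Complex.ofReal_pow] at e1
  set G := (Real.Gamma ((α + d) / 2) : ℂ)
  set G' := (Real.Gamma ((α + (d + 2 * l : ℕ)) / 2) : ℂ)
  set I := fracInt α k (fun y : Euc d => polyFun V y * φ ‖y‖) x
  set I' := fracInt α k (fun y : Euc (d + 2 * l) => φ ‖y‖) x'
  have hpl : (Real.pi : ℂ) ^ l ≠ 0 := pow_ne_zero _ hpi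
  -- The same factor `Γ((α+d)/2) π^l` occurs in the dimension shift of `chi`, so it cancels from the
  -- normalised identity.
  have e3 : G * (Real.pi : ℂ) ^ l * I = polyFun V x * (G' * I') := by
    rw [mul_right_comm, e1]
    field_simp
  have hGp : G * (Real.pi : ℂ) ^ l ≠ 0 := mul_ne_zero g1 hpl
  push_cast
  rw [one_div, one_div, inv_mul_eq_div, inv_mul_eq_div, ← mul_div_assoc, div_eq_div_iff c2 c1]
  refine mul_left_cancel₀ hGp ?_
  linear_combination polyFun V x * I' * e2 - (chi (d + 2 * l) k α : ℂ) * e3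

end

/-! ### The main theorem -/

theorem nontrivial_euc {n : ℕ} (hn : 1 ≤ n) : Nontrivial (Euc n) := by
  have : Nonempty (Fin n) := ⟨⟨0, hn⟩⟩
  infer_instance

end FracLap

theorem mainTheorem9 (d l : ℕ) (hd : 1 ≤ d)
    (V : MvPolynomial (Fin d) ℂ) (hV : FracLap.IsSolidHarmonic V l)
    (φ : ℝ → ℂ)
    (f : EuclideanSpace ℝ (Fin d) → ℂ) (hf : ∀ y, f y = φ ‖y‖)
    (f' : EuclideanSpace ℝ (Fin (d + 2 * l)) → ℂ) (hf' : ∀ y, f' y = φ ‖y‖)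
    (α : ℝ) (x : EuclideanSpace ℝ (Fin d)) (x' : EuclideanSpace ℝ (Fin (d + 2 * l)))
    (hx : ‖x'‖ = ‖x‖) :
    -- Riesz potential, `x ≠ 0`
    (0 < α → α < (d : ℝ) → x ≠ 0 →
      Integrable (fun y : EuclideanSpace ℝ (Fin d) =>
        FracLap.polyFun V y * f y * ((‖x - y‖ ^ (α - (d : ℝ)) : ℝ) : ℂ)) →
      FracLap.RieszConverges α (fun y => FracLap.polyFun V y * f y) x ∧
      (FracLap.polyFun V x ≠ 0 → FracLap.RieszConverges α f' x') ∧
      FracLap.rieszPotential α (fun y => FracLap.polyFun V y * f y) x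
        = FracLap.polyFun V x * FracLap.rieszPotential α f' x') ∧
    -- Riesz potential, `x = 0`
    (0 < α → α < (d : ℝ) → x = 0 →
      Integrable (fun y : EuclideanSpace ℝ (Fin d) =>
        ((1 + ‖FracLap.polyFun V y‖ : ℝ) : ℂ) * f y * ((‖y‖ ^ (α - (d : ℝ)) : ℝ) : ℂ)) →
      FracLap.RieszConverges α (fun y => FracLap.polyFun V y * f y) x ∧
      FracLap.RieszConverges α f' x' ∧
      FracLap.rieszPotential α (fun y => FracLap.polyFun V y * f y) x
        = FracLap.polyFun V x * FracLap.rieszPotential α f' x') ∧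
    -- fractional Laplacian
    (0 < α → (∀ᶠ y in 𝓝 x, ContDiffAt ℝ ∞ f y) →
      Integrable (fun y : EuclideanSpace ℝ (Fin d) =>
        FracLap.polyFun V y * f y * (((1 + ‖y‖) ^ (-α - (d : ℝ)) : ℝ) : ℂ)) →
      ∃ L L' : ℂ,
        FracLap.HasFracLaplacian α (fun y => FracLap.polyFun V y * f y) x L ∧
        (V ≠ 0 → FracLap.HasFracLaplacian α f' x' L') ∧
        L = FracLap.polyFun V x * L') := by
  have := FracLap.nontrivial_euc hd
  have := FracLap.nontrivial_euc (n := d + 2 * l) (by omega)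
  obtain rfl : f = fun y => φ ‖y‖ := funext hf
  obtain rfl : f' = fun y => φ ‖y‖ := funext hf'
  refine ⟨fun _ hαd _ hi => ?_, fun _ hαd h0 hi => ?_, fun hα hsm hi => ?_⟩
  · have hc : FracLap.RieszConverges α (fun y => FracLap.polyFun V y * φ ‖y‖) x := by
      rw [FracLap.rieszConverges_iff]
      simpa only [neg_sub] using hi
    exact ⟨hc, FracLap.rieszPotential_solidHarmonic_radial hV hx hαd hc⟩
  · subst h0
    obtain rfl : x' = 0 := by simpa using hx
    have hVm : Measurable (FracLap.polyFun V) := (FracLap.continuous_polyFun V).measurable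
    -- The weight `1 + |V|` dominates both `V`, needed for convergence in dimension `d`, and `1`,
    -- needed for the lift.
    have hbdd : ∀ g : FracLap.Euc d → ℂ, Measurable g →
        (∀ y, ‖g y‖ ≤ 1 + ‖FracLap.polyFun V y‖) →
        Integrable fun y => g y * φ ‖y‖ * ((‖y‖ ^ (α - (d : ℝ)) : ℝ) : ℂ) := by
      intro g hg hle
      have hpos : ∀ y, 0 < 1 + ‖FracLap.polyFun V y‖ := fun y => by positivity
      have := hi.bdd_mul (c := 1)
        (f := fun y => g y / ((1 + ‖FracLap.polyFun V y‖ : ℝ) : ℂ))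
        (Measurable.aestronglyMeasurable
          (hg.div (Complex.measurable_ofReal.comp (measurable_const.add hVm.norm))))
        (ae_of_all _ fun y => by
          rw [norm_div, Complex.norm_real, Real.norm_of_nonneg (hpos y).le]
          exact (div_le_one (hpos y)).2 (hle y))
      refine this.congr (ae_of_all _ fun y => ?_)
      have : ((1 + ‖FracLap.polyFun V y‖ : ℝ) : ℂ) ≠ 0 := Complex.ofReal_ne_zero.2 (hpos y).ne'
      simp only
      field_simp
    have hc : FracLap.RieszConverges α (fun y => FracLap.polyFun V y * φ ‖y‖) 0 := by
      rw [FracLap.rieszConverges_iff]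
      simpa only [neg_sub, zero_sub, norm_neg] using hbdd _ hVm fun y => by linarith
    refine ⟨hc, FracLap.rieszConverges_lift_zero ?_,
      (FracLap.rieszPotential_solidHarmonic_radial hV hx hαd hc).2⟩
    simpa only [one_mul] using hbdd (fun _ => 1) measurable_const fun y => by simp
  · by_cases hV0 : V = 0
    · refine ⟨0, 0, fun k _ _ => ?_, fun h => absurd hV0 h, by simp⟩
      have h0 : FracLap.fracIntegrand α k (fun y => FracLap.polyFun V y * φ ‖y‖) x = 0 := by
        ext y
        simp [hV0, FracLap.fracIntegrand, FracLap.centeredDiff, FracLap.polyFun]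
      simp only [h0]
      exact ⟨fun ε _ => integrableOn_zero, by simp⟩
    · obtain ⟨L, h1, h2⟩ := FracLap.hasFracLaplacian_solidHarmonic_radial hV hV0 hα
        hsm.self_of_nhds (by simpa only [neg_add'] using hi) hx
      exact ⟨_, L, h1, fun _ => h2, rfl⟩
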